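/- **Setting.** Let $\widehat\Omega=(0,1)^3$ and let $p_l>r_l\ge 1$ (so $p_l\ge 2$) be integers, $l=1,2,3$. For each $l$ let $\Xi_l=\{\xi^l_1\le\dots\le\xi^l_{n_l+p_l+1}\}$ be a $p_l$-open knot vector, i.e. $\xi^l_1=\dots=\xi^l_{p_l+1}=0$ and $\xi^l_{n_l+1}=\dots=\xi^l_{n_l+p_l+1}=1$, whose internal knots $\xi^l_{p_l+2},\dots,\xi^l_{n_l}$ have multiplicity at most $p_l-r_l$. The mesh is assumed regular with constant $c_u$: for each $l$, any two non-empty knot intervals $(\xi^l_i,\xi^l_{i+1})$, $(\xi^l_k,\xi^l_{k+1})$ satisfy $\xi^l_{k+1}-\xi^l_k\le c_u(\xi^l_{i+1}-\xi^l_i)$. **Univariate projections.** For one knot vector $\Xi$ of degree $p$ let $B_{j,p}$ ($1\le j\le n$) be the B-splines given by the Cox–de Boor recursion, and let $\lambda_j^p$ be the (Schumaker) dual functionals $$\lambda^p_j(f)=\int_{\xi_j}^{\xi_{j+p+1}} f\,\frac{d^{p+1}}{dx^{p+1}}\psi_j\,dx,\qquad \psi_j(x)=g_p\Big(\frac{2x-\xi_j-\xi_{j+p+1}}{\xi_{j+p+1}-\xi_j}\Big)\,\frac{(x-\xi_{j+1})\cdots(x-\xi_{j+p})}{p!},$$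 where $g_p(x)=\int_{-1}^x \frac{p+1}{2}N_p(t)\,dt$ and $N_p$ is the Cox–de Boor B-spline of degree $p$ with the knots $-\cos(i\pi/(p+1))$, $0\le i\le p+1$. They satisfy $\lambda^p_i(B_{j,p})=\delta_{ij}$. For $v\in L^2(0,1)$ put $$\widehat\Pi_p v=\sum_{j=1}^n \lambda^p_j(v)B_{j,p},\qquad \widehat\Pi^{c,1}_{p-1}v=\frac{d}{dx}\widehat\Pi_p\int_0^x v,\qquad \widehat\Pi^{c,2}_{p-2}v=\frac{d}{dx}\widehat\Pi^{c,1}_{p-1}\int_0^x v .$$ **Projections on $\widehat\Omega$.** For $a\in\{0,1,2\}^3$ let $\Pi_{a_1a_2a_3}=P_1\otimes P_2\otimes P_3$, where $P_l$ acts in the $l$-th coordinate and is $\widehat\Pi_{p_l}$, $\widehat\Pi^{c,1}_{p_l-1}$ or $\widehat\Pi^{c,2}_{p_l-2}$ (for the knot vector $\Xi_l$) according as $a_l=0,1,2$. For scalar $\phi$, $3\times3$-matrix valued $S,T$ and vector valued $v$ set $\widehat\Pi^1_h\phi=\Pi_{000}\phi$, $$\widehat\Pi^2_hS=\begin{pmatrix}s_1&s_2&s_3\\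 s_2&s_4&s_5\\ s_3&s_5&s_6\end{pmatrix},\quad \begin{aligned}s_1&=\Pi_{200}S_{11}, & s_2&=\Pi_{110}S_{12}, & s_3&=\Pi_{101}S_{13},\\ s_4&=\Pi_{020}S_{22}, & s_5&=\Pi_{011}S_{23}, & s_6&=\Pi_{002}S_{33},\end{aligned}$$ $$\widehat\Pi^3_hT=\begin{pmatrix}\Pi_{111}T_{11}&\Pi_{201}T_{12}&\Pi_{210}T_{13}\\ \Pi_{021}T_{21}&\Pi_{111}T_{22}&\Pi_{120}T_{23}\\ \Pi_{012}T_{31}&\Pi_{102}T_{32}&\Pi_{111}T_{33}\end{pmatrix},\quad \widehat\Pi^4_hv=\begin{pmatrix}\Pi_{211}v_1\\ \Pi_{121}v_2\\ \Pi_{112}v_3\end{pmatrix}.$$ **Lemma (stability of the projections).** There is a constant $C$, depending only on $p_l,r_l$ $(l=1,2,3)$ and $c_u$, such that for all knot vectors $\Xi_1,\Xi_2,\Xi_3$ as above and every mesh element $K=\prod_{l=1}^3(\xi^l_{j_l},\xi^l_{j_l+1})\neq\emptyset$ with support extension $\tilde K=\prod_{l=1}^3(\xi^l_{j_l-p_l},\xi^l_{j_l+p_l+1})$,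 the projections below are in $L^2(K)$ and $$\|\widehat\Pi^1_h\phi\|_{L^2(K)}\le C\|\phi\|_{L^2(\tilde K)},\quad \|\widehat\Pi^2_hS\|_{L^2(K)}\le C\|S\|_{L^2(\tilde K)},\quad \|\widehat\Pi^3_hT\|_{L^2(K)}\le C\|T\|_{L^2(\tilde K)},\quad \|\widehat\Pi^4_hv\|_{L^2(K)}\le C\|v\|_{L^2(\tilde K)}$$ for all scalar $\phi$, matrix valued $S,T$ and vector valued $v$ with components in $L^2(\widehat\Omega)$. Here $\|\cdot\|^2_{L^2}$ of a vector or matrix function is the sum of the squares of the $L^2$ norms of its components. -/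

import Mathlib

open MeasureTheory Set
open scoped ENNReal NNReal

namespace SplineHessian

noncomputable section

/-! ### Univariate B-splines -/

/-- The B-spline `B_{j,p}` of degree `p` for the knots `ξ_j ≤ … ≤ ξ_{j+p+1}` (indices start at `0`),
by the Cox–de Boor recursion. Division by zero is zero in Lean, which is the convention `0/0 = 0`. -/
def bspline (ξ : ℕ → ℝ) : ℕ → ℕ → ℝ → ℝ
  | 0, j, x => (Ico (ξ j) (ξ (j + 1))).indicator (fun _ => (1 : ℝ)) x
  | p + 1, j, x =>
      (x - ξ j) / (ξ (j + p + 1) - ξ j) * bspline ξ p j x +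
        (ξ (j + p + 2) - x) / (ξ (j + p + 2) - ξ (j + 1)) * bspline ξ p (j + 1) x

/-- A `p`-open knot vector `0 = ξ_0 = … = ξ_p ≤ … ≤ ξ_n = … = ξ_{n+p} = 1`, so that there are
`n + p + 1` knots and `n` B-splines of degree `p`. The sequence is padded by `1` beyond the
index `n + p`; the padding enters no B-spline `B_{j,p}` with `j < n`. -/
structure OpenKnots (p : ℕ) where
  n : ℕ
  knot : ℕ → ℝ
  mono : Monotone knot
  knot_start : ∀ i, i ≤ p → knot i = 0
  knot_end : ∀ i, n ≤ i → knot i = 1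

namespace OpenKnots

variable {p : ℕ}

/-- The multiplicity of the value `ξ_j` in the knot vector. -/
def multiplicity (Ξ : OpenKnots p) (j : ℕ) : ℕ :=
  ((Finset.range (Ξ.n + p + 1)).filter (fun i => Ξ.knot i = Ξ.knot j)).card

/-- All internal knots have multiplicity at most `p - r`: the splines of degree `p` are `C^r`. -/
def HasRegularity (Ξ : OpenKnots p) (r : ℕ) : Prop :=
  ∀ j, p < j → j < Ξ.n → Ξ.multiplicity j + r ≤ p

/-- `(ξ_i, ξ_{i+1})` is an element of the univariate mesh. These are exactly the intervals between
consecutive breakpoints, each listed once. -/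
def IsElement (Ξ : OpenKnots p) (i : ℕ) : Prop :=
  Ξ.knot i < Ξ.knot (i + 1)

/-- Regular mesh: the largest element is at most `c` times as long as any element. -/
def IsRegular (Ξ : OpenKnots p) (c : ℝ) : Prop :=
  ∀ i k, Ξ.IsElement i → Ξ.IsElement k →
    Ξ.knot (k + 1) - Ξ.knot k ≤ c * (Ξ.knot (i + 1) - Ξ.knot i)

end OpenKnots

/-! ### The dual functionals -/

/-- The extremal points `-cos (iπ/m)`, `0 ≤ i ≤ m`, of the Chebyshev polynomial of degree `m`,
in increasing order. -/
def chebyshevKnot (m i : ℕ) : ℝ :=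
  -Real.cos (i * Real.pi / m)

/-- The transition function of order `p + 1`: the primitive of the perfect B-spline of degree `p`,
i.e. of the B-spline with the `p + 2` Chebyshev knots in `[-1, 1]`, scaled to have integral one.
It is `0` left of `-1` and `1` right of `1`. -/
def transition (p : ℕ) (x : ℝ) : ℝ :=
  ∫ t in (-1 : ℝ)..x, ((p + 1 : ℝ) / 2) * bspline (chebyshevKnot (p + 1)) p 0 t

/-- `ψ_j = G_j φ_j`, where `φ_j(x) = (x - ξ_{j+1}) ⋯ (x - ξ_{j+p}) / p!` and `G_j` is the transition
function transported from `[-1, 1]` to the support `[ξ_j, ξ_{j+p+1}]` of `B_{j,p}`. -/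
def dualKernel (ξ : ℕ → ℝ) (p j : ℕ) (x : ℝ) : ℝ :=
  transition p ((2 * x - ξ j - ξ (j + p + 1)) / (ξ (j + p + 1) - ξ j)) *
    ((∏ k ∈ Finset.range p, (x - ξ (j + k + 1))) / (p.factorial : ℝ))

/-- The dual functional `λ_j^p f = ∫ f D^{p+1} ψ_j` over the support of `B_{j,p}`. The derivative
exists off finitely many points. -/
def dualFunctional (ξ : ℕ → ℝ) (p j : ℕ) (f : ℝ → ℝ) : ℝ :=
  ∫ s in (ξ j)..(ξ (j + p + 1)), f s * iteratedDeriv (p + 1) (dualKernel ξ p j) s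

/-! ### Univariate projections -/

/-- `Π_p v = ∑_j (λ_j^p v) B_{j,p}`. -/
def proj {p : ℕ} (Ξ : OpenKnots p) (v : ℝ → ℝ) (x : ℝ) : ℝ :=
  ∑ j ∈ Finset.range Ξ.n, dualFunctional Ξ.knot p j v * bspline Ξ.knot p j x

/-- `Π^{c,1}_{p-1} v = d/dx Π_p ∫_0^x v`. -/
def projC1 {p : ℕ} (Ξ : OpenKnots p) (v : ℝ → ℝ) : ℝ → ℝ :=
  deriv (proj Ξ (fun x => ∫ t in (0 : ℝ)..x, v t))

/-- `Π^{c,2}_{p-2} v = d/dx Π^{c,1}_{p-1} ∫_0^x v`. -/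
def projC2 {p : ℕ} (Ξ : OpenKnots p) (v : ℝ → ℝ) : ℝ → ℝ :=
  deriv (projC1 Ξ (fun x => ∫ t in (0 : ℝ)..x, v t))

/-! ### Tensor products and the projections of the parametric Hessian complex -/

/-- The action of a univariate operator on the `l`-th coordinate. -/
def actOn (l : Fin 3) (T : (ℝ → ℝ) → ℝ → ℝ) (f : (Fin 3 → ℝ) → ℝ) : (Fin 3 → ℝ) → ℝ :=
  fun x => T (fun t => f (Function.update x l t)) (x l)

/-- The tensor product `T₀ ⊗ T₁ ⊗ T₂`, that is `f ↦ T₀ (T₁ (T₂ f))` with `T_l` acting on the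
`l`-th coordinate. -/
def tensor (T₀ T₁ T₂ : (ℝ → ℝ) → ℝ → ℝ) (f : (Fin 3 → ℝ) → ℝ) : (Fin 3 → ℝ) → ℝ :=
  actOn 0 T₀ (actOn 1 T₁ (actOn 2 T₂ f))

variable {p : Fin 3 → ℕ}

/-- `Π^1_h`, on scalar functions. -/
def proj1 (Ξ : ∀ l, OpenKnots (p l)) (f : (Fin 3 → ℝ) → ℝ) : (Fin 3 → ℝ) → ℝ :=
  tensor (proj (Ξ 0)) (proj (Ξ 1)) (proj (Ξ 2)) f

/-- `Π^2_h = SYM(…)`, on matrix functions; it reads the entries `11, 12, 13, 22, 23, 33`. -/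
def proj2 (Ξ : ∀ l, OpenKnots (p l)) (S : (Fin 3 → ℝ) → Matrix (Fin 3) (Fin 3) ℝ) :
    (Fin 3 → ℝ) → Matrix (Fin 3) (Fin 3) ℝ :=
  let s₁ := tensor (projC2 (Ξ 0)) (proj (Ξ 1)) (proj (Ξ 2)) (fun x => S x 0 0)
  let s₂ := tensor (projC1 (Ξ 0)) (projC1 (Ξ 1)) (proj (Ξ 2)) (fun x => S x 0 1)
  let s₃ := tensor (projC1 (Ξ 0)) (proj (Ξ 1)) (projC1 (Ξ 2)) (fun x => S x 0 2)
  let s₄ := tensor (proj (Ξ 0)) (projC2 (Ξ 1)) (proj (Ξ 2)) (fun x => S x 1 1)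
  let s₅ := tensor (proj (Ξ 0)) (projC1 (Ξ 1)) (projC1 (Ξ 2)) (fun x => S x 1 2)
  let s₆ := tensor (proj (Ξ 0)) (proj (Ξ 1)) (projC2 (Ξ 2)) (fun x => S x 2 2)
  fun x => !![s₁ x, s₂ x, s₃ x; s₂ x, s₄ x, s₅ x; s₃ x, s₅ x, s₆ x]

/-- `Π^3_h = MAT(…)`, on matrix functions. -/
def proj3 (Ξ : ∀ l, OpenKnots (p l)) (T : (Fin 3 → ℝ) → Matrix (Fin 3) (Fin 3) ℝ) :
    (Fin 3 → ℝ) → Matrix (Fin 3) (Fin 3) ℝ :=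
  let m₁ := tensor (projC1 (Ξ 0)) (projC1 (Ξ 1)) (projC1 (Ξ 2)) (fun x => T x 0 0)
  let m₂ := tensor (projC2 (Ξ 0)) (proj (Ξ 1)) (projC1 (Ξ 2)) (fun x => T x 0 1)
  let m₃ := tensor (projC2 (Ξ 0)) (projC1 (Ξ 1)) (proj (Ξ 2)) (fun x => T x 0 2)
  let m₄ := tensor (proj (Ξ 0)) (projC2 (Ξ 1)) (projC1 (Ξ 2)) (fun x => T x 1 0)
  let m₅ := tensor (projC1 (Ξ 0)) (projC1 (Ξ 1)) (projC1 (Ξ 2)) (fun x => T x 1 1)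
  let m₆ := tensor (projC1 (Ξ 0)) (projC2 (Ξ 1)) (proj (Ξ 2)) (fun x => T x 1 2)
  let m₇ := tensor (proj (Ξ 0)) (projC1 (Ξ 1)) (projC2 (Ξ 2)) (fun x => T x 2 0)
  let m₈ := tensor (projC1 (Ξ 0)) (proj (Ξ 1)) (projC2 (Ξ 2)) (fun x => T x 2 1)
  let m₉ := tensor (projC1 (Ξ 0)) (projC1 (Ξ 1)) (projC1 (Ξ 2)) (fun x => T x 2 2)
  fun x => !![m₁ x, m₂ x, m₃ x; m₄ x, m₅ x, m₆ x; m₇ x, m₈ x, m₉ x]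

/-- `Π^4_h`, on vector functions. -/
def proj4 (Ξ : ∀ l, OpenKnots (p l)) (v : (Fin 3 → ℝ) → Fin 3 → ℝ) :
    (Fin 3 → ℝ) → Fin 3 → ℝ :=
  let v₁ := tensor (projC2 (Ξ 0)) (projC1 (Ξ 1)) (projC1 (Ξ 2)) (fun x => v x 0)
  let v₂ := tensor (projC1 (Ξ 0)) (projC2 (Ξ 1)) (projC1 (Ξ 2)) (fun x => v x 1)
  let v₃ := tensor (projC1 (Ξ 0)) (projC1 (Ξ 1)) (projC2 (Ξ 2)) (fun x => v x 2)
  fun x => ![v₁ x, v₂ x, v₃ x]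

/-! ### Mesh elements and `L²` norms -/

/-- The parametric domain `(0,1)³`. -/
def cube : Set (Fin 3 → ℝ) :=
  univ.pi (fun _ => Ioo (0 : ℝ) 1)

/-- The mesh element `K = ∏_l (ξ^l_{j_l}, ξ^l_{j_l+1})`. -/
def element (Ξ : ∀ l, OpenKnots (p l)) (j : Fin 3 → ℕ) : Set (Fin 3 → ℝ) :=
  univ.pi (fun l => Ioo ((Ξ l).knot (j l)) ((Ξ l).knot (j l + 1)))

/-- The support extension `∏_l (ξ^l_{j_l-p_l}, ξ^l_{j_l+p_l+1})`. For a mesh element, `p_l ≤ j_l`. -/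
def extension (Ξ : ∀ l, OpenKnots (p l)) (j : Fin 3 → ℕ) : Set (Fin 3 → ℝ) :=
  univ.pi (fun l => Ioo ((Ξ l).knot (j l - p l)) ((Ξ l).knot (j l + p l + 1)))

/-- `w ∈ L²(D)`, for a scalar function. -/
def MemL2 (D : Set (Fin 3 → ℝ)) (w : (Fin 3 → ℝ) → ℝ) : Prop :=
  MemLp w 2 (volume.restrict D)

/-- `‖w‖_{L²(D)}`. -/
def normL2 (D : Set (Fin 3 → ℝ)) (w : (Fin 3 → ℝ) → ℝ) : ℝ≥0∞ :=
  eLpNorm w 2 (volume.restrict D)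

/-- `‖v‖_{L²(D)} = (∑_i ‖v_i‖²)^{1/2}`. -/
def vecNormL2 (D : Set (Fin 3 → ℝ)) (v : (Fin 3 → ℝ) → Fin 3 → ℝ) : ℝ≥0∞ :=
  (∑ i, normL2 D (fun x => v x i) ^ 2) ^ (1 / 2 : ℝ)

/-- `‖M‖_{L²(D)} = (∑_{i,j} ‖M_{ij}‖²)^{1/2}`. -/
def matNormL2 (D : Set (Fin 3 → ℝ)) (M : (Fin 3 → ℝ) → Matrix (Fin 3) (Fin 3) ℝ) : ℝ≥0∞ :=
  (∑ i, ∑ j, normL2 D (fun x => M x i j) ^ 2) ^ (1 / 2 : ℝ)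

end

end SplineHessian

open SplineHessian

namespace SplineHessian

/-! ### B-splines for monotone knots -/

section Bspline

variable {ξ : ℕ → ℝ}

/-! On one element of length `h`, each of the three univariate projections is an integral operator
over the support extension `J`, with a kernel of size at most a constant over `h`; mesh regularity
makes `|J|` comparable to `h`. Cauchy–Schwarz then bounds the operator from `L²(J)` to `L²` of the
element by (kernel bound) · `|J|`, uniformly in the mesh. The estimate passes to products by
applying it to almost every slice, one coordinate at a time.

The kernel is a finite sum of density of `λ_j` times (a derivative of) `B_j`, over the `p + 1`
B-splines alive on the element. The density is `D^{p+1} ψ_j`; transporting it affinely to `[-1, 1]`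
shows that it is at most `N` over the length of the support, with `N` depending on `p` only
(`exists_dualKernel_bound`). The B-splines are smooth inside the element, where each derivative
costs a factor `1/h` (`scaledC2_bspline`).

The difficulty in the commuting projections is that `∫_0^x v` is not local. With `a` the left end of
`J`, the primitive splits into `∫_a^x v`, which is local, and a constant; the double primitive
splits likewise up to an affine function. These remainders disappear after one, respectively two,
differentiations because the projection reproduces affine functions on the element. Full duality of
the `λ_j` is not needed for this: it suffices that `λ_j(1) = 1` and that `λ_j(x)` is the Greville
point (`dualFunctional_one_id`, two integrations by parts), together with partition of unity and
linear precision of the B-splines (`sum_bspline`, `sum_greville_bspline`). Each local primitive,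
moved onto the density by Fubini, gains a factor `|J|`, which balances the `1/h` lost by the
derivative.

`exists_isKernelOp` collects the univariate facts, `IsKernelOp.memLp_prod` is the slice-wise
Cauchy–Schwarz estimate, and `memLp_tensor` iterates it over the three coordinates. -/

lemma bspline_succ (ξ : ℕ → ℝ) (p j : ℕ) (x : ℝ) :
    bspline ξ (p + 1) j x = (x - ξ j) / (ξ (j + p + 1) - ξ j) * bspline ξ p j x +
        (ξ (j + p + 2) - x) / (ξ (j + p + 2) - ξ (j + 1)) * bspline ξ p (j + 1) x := rfl

lemma bspline_eq_zero_of_lt (hξ : Monotone ξ) {x : ℝ} (p : ℕ) :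
    ∀ j, x < ξ j → bspline ξ p j x = 0 := by
  induction p with
  | zero =>
    intro j h
    exact indicator_of_notMem (fun hx => absurd hx.1 (not_le.2 h)) _
  | succ p ih =>
    intro j h
    rw [bspline_succ, ih j h, ih (j + 1) (h.trans_le (hξ (Nat.le_succ j)))]
    ring

lemma bspline_eq_zero_of_ge (hξ : Monotone ξ) {x : ℝ} (p : ℕ) :
    ∀ j, ξ (j + p + 1) ≤ x → bspline ξ p j x = 0 := by
  induction p with
  | zero =>
    intro j h
    exact indicator_of_notMem (fun hx => absurd hx.2 (not_lt.2 h)) _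
  | succ p ih =>
    intro j h
    rw [bspline_succ, ih j ((hξ (by omega)).trans h), ih (j + 1) (le_of_eq_of_le (by congr 1; omega) h)]
    ring

lemma measurable_bspline (ξ : ℕ → ℝ) (p : ℕ) : ∀ j, Measurable (bspline ξ p j) := by
  induction p with
  | zero => intro j; exact measurable_const.indicator measurableSet_Ico
  | succ p ih =>
    intro j
    have h1 := ih j
    have h2 := ih (j + 1)
    have : bspline ξ (p + 1) j = fun x => (x - ξ j) / (ξ (j + p + 1) - ξ j) * bspline ξ p j x +
        (ξ (j + p + 2) - x) / (ξ (j + p + 2) - ξ (j + 1)) * bspline ξ p (j + 1) x := rfl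
    rw [this]
    fun_prop

lemma bspline_congr {ξ η : ℕ → ℝ} (p : ℕ) :
    ∀ j, (∀ i, j ≤ i → i ≤ j + p + 1 → ξ i = η i) → bspline ξ p j = bspline η p j := by
  induction p with
  | zero =>
    intro j h
    funext x
    simp only [bspline]
    rw [h j le_rfl (by omega), h (j + 1) (by omega) (by omega)]
  | succ p ih =>
    intro j h
    funext x
    rw [bspline_succ, bspline_succ, ih j (fun i h1 h2 => h i h1 (by omega)),
      ih (j + 1) (fun i h1 h2 => h i (by omega) (by omega)), h j le_rfl (by omega),
      h (j + p + 1) (by omega) (by omega), h (j + p + 2) (by omega) (by omega),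
      h (j + 1) (by omega) (by omega)]

/-- One step of de Boor's algorithm. -/
lemma sum_mul_bspline_succ (hξ : Monotone ξ) {x : ℝ} {m q N : ℕ} (hx : x ∈ Ico (ξ m) (ξ (m + 1)))
    (hq : q < m) (hN : m < N) (c : ℕ → ℝ) :
    ∑ j ∈ Finset.range N, c j * bspline ξ (q + 1) j x =
      ∑ j ∈ Finset.range N, (c j * ((x - ξ j) / (ξ (j + q + 1) - ξ j)) +
        c (j - 1) * ((ξ (j + q + 1) - x) / (ξ (j + q + 1) - ξ j))) * bspline ξ q j x := by
  set F : ℕ → ℝ := fun j =>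
    c (j - 1) * ((ξ (j + q + 1) - x) / (ξ (j + q + 1) - ξ j)) * bspline ξ q j x with hF
  -- At `j = 0` the index `j - 1` is truncated to `0`. This is harmless: since `q < m`, the support
  -- of the B-spline with index `0` ends at or before `ξ m ≤ x`.
  have h0 : F 0 = 0 := by
    simp only [hF]
    rw [bspline_eq_zero_of_ge hξ q 0 ((hξ (by omega)).trans hx.1), mul_zero]
  have hN0 : F N = 0 := by
    simp only [hF]
    rw [bspline_eq_zero_of_lt hξ q N (hx.2.trans_le (hξ (by omega))), mul_zero]
  have hshift : ∑ j ∈ Finset.range N, F (j + 1) = ∑ j ∈ Finset.range N, F j := by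
    have h1 := Finset.sum_range_succ' F N
    have h2 := Finset.sum_range_succ F N
    linarith
  calc ∑ j ∈ Finset.range N, c j * bspline ξ (q + 1) j x
      = ∑ j ∈ Finset.range N,
          (c j * ((x - ξ j) / (ξ (j + q + 1) - ξ j)) * bspline ξ q j x + F (j + 1)) := by
        refine Finset.sum_congr rfl fun j _ => ?_
        simp only [hF, bspline_succ, Nat.add_sub_cancel, show j + 1 + q + 1 = j + q + 2 by omega]
        ring
    _ = _ := by
        rw [Finset.sum_add_distrib, hshift, ← Finset.sum_add_distrib]
        refine Finset.sum_congr rfl fun j _ => ?_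
        simp only [hF]
        ring

lemma bspline_eq_zero_of_knot_eq (hξ : Monotone ξ) {p j : ℕ} (h : ξ (j + p + 1) - ξ j = 0)
    (x : ℝ) : bspline ξ p j x = 0 := by
  rcases lt_or_ge x (ξ j) with hx | hx
  · exact bspline_eq_zero_of_lt hξ p j hx
  · exact bspline_eq_zero_of_ge hξ p j (by linarith)

/-- Partition of unity. -/
lemma sum_bspline (hξ : Monotone ξ) {x : ℝ} {m N : ℕ} (hx : x ∈ Ico (ξ m) (ξ (m + 1)))
    (hN : m < N) (q : ℕ) (hq : q ≤ m) : ∑ j ∈ Finset.range N, bspline ξ q j x = 1 := by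
  induction q with
  | zero =>
    rw [Finset.sum_eq_single_of_mem m (Finset.mem_range.2 hN)]
    · exact indicator_of_mem hx _
    · intro j _ hj
      rcases lt_or_gt_of_ne hj with h | h
      · exact bspline_eq_zero_of_ge hξ 0 j ((hξ (by omega)).trans hx.1)
      · exact bspline_eq_zero_of_lt hξ 0 j (hx.2.trans_le (hξ (by omega)))
  | succ q ih =>
    have h := sum_mul_bspline_succ hξ hx (by omega : q < m) hN (fun _ => 1)
    simp only [one_mul] at h
    rw [h, ← ih (by omega)]
    refine Finset.sum_congr rfl fun j _ => ?_
    by_cases hd : ξ (j + q + 1) - ξ j = 0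
    · rw [bspline_eq_zero_of_knot_eq hξ hd, mul_zero]
    · rw [← add_div, show x - ξ j + (ξ (j + q + 1) - x) = ξ (j + q + 1) - ξ j by ring,
        div_self hd, one_mul]

/-- Linear precision at the Greville points. -/
lemma sum_greville_bspline (hξ : Monotone ξ) {x : ℝ} {m N : ℕ} (hx : x ∈ Ico (ξ m) (ξ (m + 1)))
    (hN : m < N) (q : ℕ) (hq : q ≤ m) :
    ∑ j ∈ Finset.range N, (∑ k ∈ Finset.range q, ξ (j + k + 1)) * bspline ξ q j x = q * x := by
  induction q with
  | zero => simp
  | succ q ih =>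
    rw [sum_mul_bspline_succ hξ hx (by omega : q < m) hN
      (fun j => ∑ k ∈ Finset.range (q + 1), ξ (j + k + 1))]
    have h1 := sum_bspline hξ hx hN q (by omega)
    have h2 := ih (by omega)
    -- The coefficients with indices `j` and `j - 1` share the knots `ξ_{j+1}, …, ξ_{j+q}`. They
    -- differ in the remaining knot, `ξ_{j+q+1}` or `ξ_j`, and the de Boor weights average these two
    -- to `x`.
    calc _ = ∑ j ∈ Finset.range N, ((∑ k ∈ Finset.range q, ξ (j + k + 1)) * bspline ξ q j x +
            x * bspline ξ q j x) := by
          refine Finset.sum_congr rfl fun j _ => ?_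
          by_cases hd : ξ (j + q + 1) - ξ j = 0
          · simp [bspline_eq_zero_of_knot_eq hξ hd]
          rcases Nat.eq_zero_or_pos j with rfl | hj
          · rw [bspline_eq_zero_of_ge hξ q 0 ((hξ (by omega)).trans hx.1)]
            simp
          obtain ⟨i, rfl⟩ : ∃ i, j = i + 1 := ⟨j - 1, by omega⟩
          rw [← add_mul]
          congr 1
          have hA : ∑ k ∈ Finset.range (q + 1), ξ (i + 1 - 1 + k + 1) =
              ξ (i + 1) + ∑ k ∈ Finset.range q, ξ (i + 1 + k + 1) := by
            rw [Finset.sum_range_succ', add_comm]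
            congr 1
            refine Finset.sum_congr rfl fun k _ => ?_
            congr 1
            omega
          rw [hA, Finset.sum_range_succ]
          field_simp
          ring
      _ = _ := by
          rw [Finset.sum_add_distrib, ← Finset.mul_sum, h1, h2]
          push_cast
          ring

/-! ### B-splines on an element -/

/-- On a set `I`, `f` is twice differentiable and `|f⁽ⁱ⁾| ≤ M / hⁱ` for `i ≤ 2`. -/
def ScaledC2 (I : Set ℝ) (h M : ℝ) (f : ℝ → ℝ) : Prop :=
  ∃ f₁ f₂ : ℝ → ℝ, ∀ x ∈ I, HasDerivAt f (f₁ x) x ∧ HasDerivAt f₁ (f₂ x) x ∧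
    |f x| ≤ M ∧ |f₁ x| ≤ M / h ∧ |f₂ x| ≤ M / h ^ 2

lemma ScaledC2.add {I : Set ℝ} {h M N : ℝ} {f g : ℝ → ℝ} (hf : ScaledC2 I h M f)
    (hg : ScaledC2 I h N g) : ScaledC2 I h (M + N) (fun x => f x + g x) := by
  obtain ⟨f₁, f₂, hf⟩ := hf
  obtain ⟨g₁, g₂, hg⟩ := hg
  refine ⟨fun x => f₁ x + g₁ x, fun x => f₂ x + g₂ x, fun x hx => ?_⟩
  obtain ⟨a1, a2, a3, a4, a5⟩ := hf x hx
  obtain ⟨b1, b2, b3, b4, b5⟩ := hg x hx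
  refine ⟨a1.add b1, a2.add b2, (abs_add_le _ _).trans (add_le_add a3 b3), ?_, ?_⟩
  · rw [add_div]; exact (abs_add_le _ _).trans (add_le_add a4 b4)
  · rw [add_div]; exact (abs_add_le _ _).trans (add_le_add a5 b5)

/-- The factor `3` is the number of terms in the Leibniz rule for the second derivative, counted
with multiplicity; the affine factor has no second derivative. -/
lemma ScaledC2.affine_mul {I : Set ℝ} {h M c d : ℝ} {f : ℝ → ℝ} (hh : 0 < h)
    (hc : |c| ≤ 1 / h) (hd : ∀ x ∈ I, |c * x + d| ≤ 1) (hf : ScaledC2 I h M f) :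
    ScaledC2 I h (3 * M) (fun x => (c * x + d) * f x) := by
  obtain ⟨f₁, f₂, hf⟩ := hf
  refine ⟨fun x => c * f x + (c * x + d) * f₁ x, fun x => c * f₁ x + (c * f₁ x + (c * x + d) * f₂ x),
    fun x hx => ?_⟩
  obtain ⟨a1, a2, a3, a4, a5⟩ := hf x hx
  have hl : HasDerivAt (fun x : ℝ => c * x + d) c x := by
    simpa using ((hasDerivAt_id x).const_mul c).add_const d
  have hM : 0 ≤ M := (abs_nonneg _).trans a3
  have e0 : |(c * x + d) * f x| ≤ M := by
    rw [abs_mul]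
    calc _ ≤ 1 * M := mul_le_mul (hd x hx) a3 (abs_nonneg _) zero_le_one
      _ = M := one_mul M
  have e1 : |c * f x| ≤ M / h := by
    rw [abs_mul]
    calc _ ≤ 1 / h * M := mul_le_mul hc a3 (abs_nonneg _) (by positivity)
      _ = M / h := by ring
  have e2 : |(c * x + d) * f₁ x| ≤ M / h := by
    rw [abs_mul]
    calc _ ≤ 1 * (M / h) := mul_le_mul (hd x hx) a4 (abs_nonneg _) zero_le_one
      _ = M / h := one_mul _
  have e3 : |c * f₁ x| ≤ M / h ^ 2 := by
    rw [abs_mul]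
    calc _ ≤ 1 / h * (M / h) := mul_le_mul hc a4 (abs_nonneg _) (by positivity)
      _ = M / h ^ 2 := by field_simp
  have e4 : |(c * x + d) * f₂ x| ≤ M / h ^ 2 := by
    rw [abs_mul]
    calc _ ≤ 1 * (M / h ^ 2) := mul_le_mul (hd x hx) a5 (abs_nonneg _) zero_le_one
      _ = M / h ^ 2 := one_mul _
  have k1 : 0 ≤ M / h := by positivity
  have k2 : 0 ≤ M / h ^ 2 := by positivity
  refine ⟨hl.mul a1, (a1.const_mul c).add (hl.mul a2), by linarith, ?_, ?_⟩
  · rw [show 3 * M / h = 3 * (M / h) by ring]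
    have := abs_add_le (c * f x) ((c * x + d) * f₁ x)
    linarith
  · rw [show 3 * M / h ^ 2 = 3 * (M / h ^ 2) by ring]
    have h1 := abs_add_le (c * f₁ x) (c * f₁ x + (c * x + d) * f₂ x)
    have h2 := abs_add_le (c * f₁ x) ((c * x + d) * f₂ x)
    linarith

lemma ScaledC2.const {I : Set ℝ} {h M : ℝ} (hh : 0 < h) (c : ℝ) (hc : |c| ≤ M) :
    ScaledC2 I h M (fun _ => c) := by
  have hM : 0 ≤ M := (abs_nonneg _).trans hc
  refine ⟨fun _ => 0, fun _ => 0, fun x _ => ⟨hasDerivAt_const x c, hasDerivAt_const x 0, hc, ?_, ?_⟩⟩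
  · rw [abs_zero]; positivity
  · rw [abs_zero]; positivity

lemma ScaledC2.congr {I : Set ℝ} (hI : IsOpen I) {h M : ℝ} {f g : ℝ → ℝ} (hfg : ∀ x ∈ I, f x = g x)
    (hg : ScaledC2 I h M g) : ScaledC2 I h M f := by
  obtain ⟨g₁, g₂, hg⟩ := hg
  refine ⟨g₁, g₂, fun x hx => ?_⟩
  obtain ⟨a1, a2, a3, a4, a5⟩ := hg x hx
  refine ⟨a1.congr_of_eventuallyEq ?_, a2, by rwa [hfg x hx], a4, a5⟩
  filter_upwards [hI.mem_nhds hx] with y hy using hfg y hy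

lemma ScaledC2.deriv_spec {I : Set ℝ} (hI : IsOpen I) {h M : ℝ} {f : ℝ → ℝ}
    (hf : ScaledC2 I h M f) {x : ℝ} (hx : x ∈ I) :
    DifferentiableAt ℝ f x ∧ DifferentiableAt ℝ (deriv f) x ∧ |f x| ≤ M ∧ |deriv f x| ≤ M / h ∧
      |deriv (deriv f) x| ≤ M / h ^ 2 := by
  obtain ⟨f₁, f₂, hf⟩ := hf
  have he : deriv f =ᶠ[nhds x] f₁ := by
    filter_upwards [hI.mem_nhds hx] with y hy using (hf y hy).1.deriv
  obtain ⟨a1, a2, a3, a4, a5⟩ := hf x hx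
  have a2' := a2.congr_of_eventuallyEq he
  exact ⟨a1.differentiableAt, a2'.differentiableAt, a3, by rwa [a1.deriv], by rwa [a2'.deriv]⟩

/-- A B-spline either vanishes on the element or has a support containing it. In the second case the
Cox–de Boor weight in front of it is affine, takes values in `[0, 1]` on the element, and has slope
at most `1/h`. Each degree adds two such products, hence the factor `3 + 3 = 6`. Vanishing
denominators occur only in front of B-splines that vanish on the element. -/
lemma scaledC2_bspline (hξ : Monotone ξ) {m : ℕ} (hm : ξ m < ξ (m + 1)) (p : ℕ) :
    ∀ j, ScaledC2 (Ioo (ξ m) (ξ (m + 1))) (ξ (m + 1) - ξ m) (6 ^ p) (bspline ξ p j) := by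
  have hh : 0 < ξ (m + 1) - ξ m := by linarith
  have hzero : ∀ q j : ℕ, ∀ x ∈ Ioo (ξ m) (ξ (m + 1)), ¬ (j ≤ m ∧ m ≤ j + q) →
      bspline ξ q j x = 0 := by
    intro q j x hx hj
    rcases lt_or_ge m j with h | h
    · exact bspline_eq_zero_of_lt hξ q j (hx.2.trans_le (hξ (by omega)))
    · exact bspline_eq_zero_of_ge hξ q j ((hξ (by omega)).trans hx.1.le)
  induction p with
  | zero =>
    intro j
    by_cases hj : j = m
    · refine ScaledC2.congr isOpen_Ioo (g := fun _ => 1) (fun x hx => ?_)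
        (ScaledC2.const hh _ (by simp))
      subst hj
      exact indicator_of_mem (Ioo_subset_Ico_self hx) _
    · exact ScaledC2.congr isOpen_Ioo (g := fun _ => 0)
        (fun x hx => hzero 0 j x hx (by omega)) (ScaledC2.const hh _ (by simp))
  | succ p ih =>
    have key : ∀ (i : ℕ) (c d : ℝ), ((i ≤ m ∧ m ≤ i + p) → |c| ≤ 1 / (ξ (m + 1) - ξ m) ∧
        ∀ x ∈ Ioo (ξ m) (ξ (m + 1)), |c * x + d| ≤ 1) →
        ScaledC2 (Ioo (ξ m) (ξ (m + 1))) (ξ (m + 1) - ξ m) (3 * 6 ^ p)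
          (fun x => (c * x + d) * bspline ξ p i x) := by
      intro i c d hcd
      by_cases hi : i ≤ m ∧ m ≤ i + p
      · exact (ih i).affine_mul hh (hcd hi).1 (hcd hi).2
      · exact ScaledC2.congr isOpen_Ioo (g := fun _ => 0)
          (fun x hx => by rw [hzero p i x hx hi, mul_zero])
          (ScaledC2.const hh _ (by rw [abs_zero]; positivity))
    intro j
    have h1 := key j (1 / (ξ (j + p + 1) - ξ j)) (-(ξ j) / (ξ (j + p + 1) - ξ j)) (by
      intro hj
      have k1 : ξ j ≤ ξ m := hξ hj.1
      have k2 : ξ (m + 1) ≤ ξ (j + p + 1) := hξ (by omega)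
      have k3 : 0 < ξ (j + p + 1) - ξ j := by linarith
      refine ⟨?_, fun x hx => ?_⟩
      · rw [abs_of_pos (by positivity)]
        exact one_div_le_one_div_of_le hh (by linarith)
      · rw [show 1 / (ξ (j + p + 1) - ξ j) * x + -(ξ j) / (ξ (j + p + 1) - ξ j) =
          (x - ξ j) / (ξ (j + p + 1) - ξ j) by ring, abs_of_nonneg
          (div_nonneg (by linarith [hx.1]) k3.le), div_le_one k3]
        linarith [hx.2])
    have h2 := key (j + 1) (-1 / (ξ (j + p + 2) - ξ (j + 1)))
      (ξ (j + p + 2) / (ξ (j + p + 2) - ξ (j + 1))) (by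
      intro hj
      have k1 : ξ (j + 1) ≤ ξ m := hξ hj.1
      have k2 : ξ (m + 1) ≤ ξ (j + p + 2) := hξ (by omega)
      have k3 : 0 < ξ (j + p + 2) - ξ (j + 1) := by linarith
      refine ⟨?_, fun x hx => ?_⟩
      · rw [abs_div, abs_neg, abs_one, abs_of_pos k3]
        exact one_div_le_one_div_of_le hh (by linarith)
      · rw [show -1 / (ξ (j + p + 2) - ξ (j + 1)) * x +
          ξ (j + p + 2) / (ξ (j + p + 2) - ξ (j + 1)) =
          (ξ (j + p + 2) - x) / (ξ (j + p + 2) - ξ (j + 1)) by ring, abs_of_nonneg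
          (div_nonneg (by linarith [hx.2]) k3.le), div_le_one k3]
        linarith [hx.1])
    have h3 := h1.add h2
    rw [show (3 * 6 ^ p + 3 * 6 ^ p : ℝ) = 6 ^ (p + 1) by ring] at h3
    refine ScaledC2.congr isOpen_Ioo (fun x _ => ?_) h3
    rw [bspline_succ]
    ring

/-! ### Smoothness of B-splines for distinct knots -/

lemma hasDerivAt_bspline_zero {x : ℝ} (hx : x ∉ range ξ) (j : ℕ) :
    HasDerivAt (bspline ξ 0 j) 0 x := by
  have h1 : x ≠ ξ j := fun h => hx ⟨j, h.symm⟩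
  have h2 : x ≠ ξ (j + 1) := fun h => hx ⟨j + 1, h.symm⟩
  refine (hasDerivAt_const x (bspline ξ 0 j x)).congr_of_eventuallyEq ?_
  by_cases hI : x ∈ Ico (ξ j) (ξ (j + 1))
  · have : Ioo (ξ j) (ξ (j + 1)) ∈ nhds x := Ioo_mem_nhds (lt_of_le_of_ne hI.1 h1.symm) hI.2
    filter_upwards [this] with y hy
    rw [bspline, bspline, indicator_of_mem hI, indicator_of_mem (Ioo_subset_Ico_self hy)]
  · have : (Icc (ξ j) (ξ (j + 1)))ᶜ ∈ nhds x := by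
      refine isClosed_Icc.isOpen_compl.mem_nhds fun h => hI ⟨h.1, lt_of_le_of_ne h.2 h2⟩
    filter_upwards [this] with y hy
    rw [bspline, bspline, indicator_of_notMem hI,
      indicator_of_notMem (fun h => hy (Ico_subset_Icc_self h))]

/-- The classical derivative formula, by differentiating the Cox–de Boor recursion. Distinct knots
keep every denominator nonzero; the formula is needed only for the Chebyshev knots of the transition
function. -/
lemma hasDerivAt_bspline (hξ : StrictMono ξ) {x : ℝ} (hx : x ∉ range ξ) (p : ℕ) :
    ∀ j, HasDerivAt (bspline ξ (p + 1) j)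
      ((p + 1) * (1 / (ξ (j + p + 1) - ξ j) * bspline ξ p j x +
        -1 / (ξ (j + p + 2) - ξ (j + 1)) * bspline ξ p (j + 1) x)) x := by
  have hstep : ∀ (q j : ℕ) (b₀ b₁ : ℝ), HasDerivAt (bspline ξ q j) b₀ x →
      HasDerivAt (bspline ξ q (j + 1)) b₁ x → HasDerivAt (bspline ξ (q + 1) j)
        (1 / (ξ (j + q + 1) - ξ j) * bspline ξ q j x + (x - ξ j) / (ξ (j + q + 1) - ξ j) * b₀ +
        (-1 / (ξ (j + q + 2) - ξ (j + 1)) * bspline ξ q (j + 1) x +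
          (ξ (j + q + 2) - x) / (ξ (j + q + 2) - ξ (j + 1)) * b₁)) x := by
    intro q j b₀ b₁ h0 h1
    have l0 : HasDerivAt (fun y : ℝ => (y - ξ j) / (ξ (j + q + 1) - ξ j))
        (1 / (ξ (j + q + 1) - ξ j)) x := ((hasDerivAt_id x).sub_const _).div_const _
    have l1 : HasDerivAt (fun y : ℝ => (ξ (j + q + 2) - y) / (ξ (j + q + 2) - ξ (j + 1)))
        (-1 / (ξ (j + q + 2) - ξ (j + 1))) x := ((hasDerivAt_id x).const_sub _).div_const _
    exact (l0.mul h0).add (l1.mul h1)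
  induction p with
  | zero =>
    intro j
    refine (hstep 0 j 0 0 (hasDerivAt_bspline_zero hx j)
      (hasDerivAt_bspline_zero hx (j + 1))).congr_deriv ?_
    push_cast
    ring
  | succ p ih =>
    intro j
    refine (hstep (p + 1) j _ _ (ih j) (ih (j + 1))).congr_deriv ?_
    have d0 : ξ (j + p + 1) - ξ j ≠ 0 := (sub_pos.2 (hξ (by omega))).ne'
    have d1 : ξ (j + p + 2) - ξ (j + 1) ≠ 0 := (sub_pos.2 (hξ (by omega))).ne'
    have d2 : ξ (j + p + 3) - ξ (j + 2) ≠ 0 := (sub_pos.2 (hξ (by omega))).ne'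
    have e0 : ξ (j + p + 2) - ξ j ≠ 0 := (sub_pos.2 (hξ (by omega))).ne'
    have e1 : ξ (j + p + 3) - ξ (j + 1) ≠ 0 := (sub_pos.2 (hξ (by omega))).ne'
    have i1 : j + (p + 1) + 1 = j + p + 2 := by omega
    have i2 : j + (p + 1) + 2 = j + p + 3 := by omega
    have i3 : j + 1 + p + 1 = j + p + 2 := by omega
    have i4 : j + 1 + p + 2 = j + p + 3 := by omega
    have i5 : j + 1 + 1 = j + 2 := by omega
    simp only [bspline_succ, i1, i2, i3, i4, i5]
    generalize bspline ξ p j x = b0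
    generalize bspline ξ p (j + 1) x = b1
    generalize bspline ξ p (j + 2) x = b2
    push_cast
    field_simp
    ring

lemma continuous_bspline (hξ : StrictMono ξ) (p : ℕ) : ∀ j, Continuous (bspline ξ (p + 1) j) := by
  induction p with
  | zero =>
    intro j
    have h0 : ξ j < ξ (j + 1) := hξ (by omega)
    have h1 : ξ (j + 1) < ξ (j + 2) := hξ (by omega)
    have : bspline ξ 1 j = fun x => max 0 (min ((x - ξ j) / (ξ (j + 1) - ξ j))
        ((ξ (j + 2) - x) / (ξ (j + 2) - ξ (j + 1)))) := by
      funext x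
      have k0 : 0 < ξ (j + 1) - ξ j := by linarith
      have k1 : 0 < ξ (j + 2) - ξ (j + 1) := by linarith
      have hx : bspline ξ 1 j x = (x - ξ j) / (ξ (j + 1) - ξ j) * bspline ξ 0 j x +
        (ξ (j + 2) - x) / (ξ (j + 2) - ξ (j + 1)) * bspline ξ 0 (j + 1) x := rfl
      rw [hx]
      rcases lt_or_ge x (ξ j) with a | a
      · rw [bspline_eq_zero_of_lt hξ.monotone 0 j a,
          bspline_eq_zero_of_lt hξ.monotone 0 (j + 1) (a.trans h0), max_eq_left]
        · ring
        · exact (min_le_left _ _).trans (div_nonpos_of_nonpos_of_nonneg (by linarith) k0.le)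
      rcases lt_or_ge x (ξ (j + 1)) with b | b
      · rw [bspline_eq_zero_of_lt hξ.monotone 0 (j + 1) b,
          show bspline ξ 0 j x = 1 from indicator_of_mem (show x ∈ Ico _ _ from ⟨a, b⟩) _, min_eq_left, max_eq_right]
        · ring
        · exact div_nonneg (by linarith) k0.le
        · exact ((div_le_one k0).2 (by linarith)).trans ((one_le_div k1).2 (by linarith))
      rw [bspline_eq_zero_of_ge hξ.monotone 0 j b]
      rcases lt_or_ge x (ξ (j + 2)) with c | c
      · rw [show bspline ξ 0 (j + 1) x = 1 from indicator_of_mem (show x ∈ Ico _ _ from ⟨b, c⟩) _, min_eq_right,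
          max_eq_right]
        · ring
        · exact div_nonneg (by linarith) k1.le
        · exact ((div_le_one k1).2 (by linarith)).trans ((one_le_div k0).2 (by linarith))
      · rw [bspline_eq_zero_of_ge hξ.monotone 0 (j + 1) c, max_eq_left]
        · ring
        · exact (min_le_right _ _).trans (div_nonpos_of_nonpos_of_nonneg (by linarith) k1.le)
    rw [this]
    fun_prop
  | succ p ih =>
    intro j
    have h1 := ih j
    have h2 := ih (j + 1)
    have : bspline ξ (p + 1 + 1) j = fun x => (x - ξ j) / (ξ (j + (p + 1) + 1) - ξ j) *
        bspline ξ (p + 1) j x + (ξ (j + (p + 1) + 2) - x) / (ξ (j + (p + 1) + 2) - ξ (j + 1)) *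
          bspline ξ (p + 1) (j + 1) x := rfl
    rw [this]
    fun_prop

/-! ### Boundedness and integrals of B-splines. -/

lemma bspline_bounded (hξ : StrictMono ξ) (p : ℕ) : ∀ j, ∃ M, ∀ x, |bspline ξ p j x| ≤ M := by
  induction p with
  | zero =>
    refine fun j => ⟨1, fun x => ?_⟩
    rw [bspline]
    by_cases h : x ∈ Ico (ξ j) (ξ (j + 1))
    · rw [indicator_of_mem h, abs_one]
    · rw [indicator_of_notMem h, abs_zero]; exact zero_le_one
  | succ p ih =>
    intro j
    obtain ⟨M, hM⟩ := isCompact_Icc.exists_bound_of_continuousOn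
      (s := Icc (ξ j) (ξ (j + (p + 1) + 1))) (continuous_bspline hξ p j).continuousOn
    refine ⟨max M 0, fun x => ?_⟩
    by_cases hx : x ∈ Icc (ξ j) (ξ (j + (p + 1) + 1))
    · exact (hM x hx).trans (le_max_left _ _)
    · have : bspline ξ (p + 1) j x = 0 := by
        rcases lt_or_ge x (ξ j) with h | h
        · exact bspline_eq_zero_of_lt hξ.monotone _ _ h
        · exact bspline_eq_zero_of_ge hξ.monotone _ _ (not_lt.1 fun h' => hx ⟨h, h'.le⟩)
      rw [this, abs_zero]
      exact le_max_right _ _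

lemma intervalIntegrable_bspline (hξ : StrictMono ξ) (p j : ℕ) (a b : ℝ) :
    IntervalIntegrable (bspline ξ p j) volume a b := by
  obtain ⟨M, hM⟩ := bspline_bounded hξ p j
  exact (intervalIntegrable_const (c := M)).mono_fun
    (measurable_bspline ξ p j).aestronglyMeasurable
    (Filter.Eventually.of_forall fun x => (hM x).trans (le_abs_self M))

/-- The function `(x - ξ_j) B_{j,p+1}(x)` vanishes at both ends, the linear factor covering the case
`a = ξ_j`. By the derivative formula and the recursion, its derivative is a combination of
`B_{j,p+1}` and `B_{j+1,p}` with constant coefficients, so its zero integral determines `∫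
B_{j,p+1}` from the lower degree. -/
lemma integral_bspline (hξ : StrictMono ξ) (p : ℕ) : ∀ j a b, a ≤ ξ j → ξ (j + p + 1) ≤ b →
    ∫ x in a..b, bspline ξ p j x = (ξ (j + p + 1) - ξ j) / (p + 1) := by
  induction p with
  | zero =>
    intro j a b ha hb
    have h0 : ξ j < ξ (j + 1) := hξ (by omega)
    have hab : a ≤ b := ha.trans (h0.le.trans hb)
    have : ∫ x in a..b, bspline ξ 0 j x = ∫ x in a..b, (Ico (ξ j) (ξ (j + 1))).indicator
        (fun _ => (1 : ℝ)) x := rfl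
    rw [this, intervalIntegral.integral_of_le hab, ← integral_Icc_eq_integral_Ioc,
      integral_indicator measurableSet_Ico, Measure.restrict_restrict measurableSet_Ico,
      inter_eq_left.2 (Ico_subset_Icc_self.trans (Icc_subset_Icc ha hb))]
    simp [h0.le]
  | succ p ih =>
    intro j a b ha hb
    have hd : ξ (j + p + 2) - ξ (j + 1) ≠ 0 := (sub_pos.2 (hξ (by omega))).ne'
    have hd0 : ξ (j + p + 1) - ξ j ≠ 0 := (sub_pos.2 (hξ (by omega))).ne'
    have hab : a ≤ b := ha.trans ((hξ.monotone (by omega)).trans hb)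
    have hint := integral_eq_of_hasDerivAt_off_countable_of_le
      (fun x => (x - ξ j) * bspline ξ (p + 1) j x)
      (fun x => (p + 2) * bspline ξ (p + 1) j x -
        (p + 1) * ((ξ (j + p + 2) - ξ j) / (ξ (j + p + 2) - ξ (j + 1))) * bspline ξ p (j + 1) x)
      hab (countable_range ξ) (by have := continuous_bspline hξ p j; fun_prop)
      (fun x hx => by
        refine (((hasDerivAt_id x).sub_const (ξ j)).mul
          (hasDerivAt_bspline hξ hx.2 p j)).congr_deriv ?_
        simp only [id, bspline_succ]
        field_simp
        ring)
      (((intervalIntegrable_bspline hξ _ _ _ _).const_mul _).sub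
        ((intervalIntegrable_bspline hξ _ _ _ _).const_mul _))
    rw [intervalIntegral.integral_sub ((intervalIntegrable_bspline hξ _ _ _ _).const_mul _)
      ((intervalIntegrable_bspline hξ _ _ _ _).const_mul _), intervalIntegral.integral_const_mul,
      intervalIntegral.integral_const_mul, ih (j + 1) a b (ha.trans (hξ.monotone (by omega)))
      (le_of_eq_of_le (by congr 1; omega) hb)] at hint
    have hB : bspline ξ (p + 1) j b = 0 := bspline_eq_zero_of_ge hξ.monotone _ _ hb
    have hA : (a - ξ j) * bspline ξ (p + 1) j a = 0 := by
      rcases ha.lt_or_eq with h | h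
      · rw [bspline_eq_zero_of_lt hξ.monotone _ _ h, mul_zero]
      · rw [h, sub_self, zero_mul]
    rw [hA, hB, show j + 1 + p + 1 = j + p + 2 by omega] at hint
    rw [show j + (p + 1) + 1 = j + p + 2 by omega]
    have hp : (p + 1 : ℝ) ≠ 0 := by positivity
    have hp2 : (p + 2 : ℝ) ≠ 0 := by positivity
    push_cast
    rw [eq_div_iff (by positivity)]
    have e : (p + 1 : ℝ) * ((ξ (j + p + 2) - ξ j) / (ξ (j + p + 2) - ξ (j + 1))) *
      ((ξ (j + p + 2) - ξ (j + 1)) / (p + 1)) = ξ (j + p + 2) - ξ j := by field_simp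
    rw [e] at hint
    linarith

end Bspline

/-! ### Functions that are smooth up to a bounded top derivative -/

/-- `f` has `k` derivatives off `S`, all but the last one are continuous, and all of them are
bounded by `M` on `D`. -/
def PiecewiseSmooth (S D : Set ℝ) : ℕ → ℝ → (ℝ → ℝ) → Prop
  | 0, M, f => ∀ x ∈ D, |f x| ≤ M
  | k + 1, M, f => (∀ x ∈ D, |f x| ≤ M) ∧ Continuous f ∧
      ∃ f' : ℝ → ℝ, (∀ x, x ∉ S → HasDerivAt f (f' x) x) ∧ PiecewiseSmooth S D k M f'

namespace PiecewiseSmooth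

variable {S D : Set ℝ}

lemma mono {k : ℕ} : ∀ {M N : ℝ} {f : ℝ → ℝ}, M ≤ N → PiecewiseSmooth S D k M f →
    PiecewiseSmooth S D k N f := by
  induction k with
  | zero => exact fun h hf x hx => (hf x hx).trans h
  | succ k ih =>
    rintro M N f h ⟨h1, h2, f', h3, h4⟩
    exact ⟨fun x hx => (h1 x hx).trans h, h2, f', h3, ih h h4⟩

lemma of_succ {k : ℕ} : ∀ {M : ℝ} {f : ℝ → ℝ}, PiecewiseSmooth S D (k + 1) M f →
    PiecewiseSmooth S D k M f := by
  induction k with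
  | zero => exact fun hf => hf.1
  | succ k ih =>
    rintro M f ⟨h1, h2, f', h3, h4⟩
    exact ⟨h1, h2, f', h3, ih h4⟩

lemma add {k : ℕ} : ∀ {M N : ℝ} {f g : ℝ → ℝ}, PiecewiseSmooth S D k M f →
    PiecewiseSmooth S D k N g → PiecewiseSmooth S D k (M + N) (fun x => f x + g x) := by
  induction k with
  | zero => exact fun hf hg x hx => (abs_add_le _ _).trans (add_le_add (hf x hx) (hg x hx))
  | succ k ih =>
    rintro M N f g ⟨f1, f2, f', f3, f4⟩ ⟨g1, g2, g', g3, g4⟩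
    exact ⟨fun x hx => (abs_add_le _ _).trans (add_le_add (f1 x hx) (g1 x hx)), f2.add g2, _,
      fun x hx => (f3 x hx).add (g3 x hx), ih f4 g4⟩

lemma mul {k : ℕ} : ∀ {M N : ℝ} {f g : ℝ → ℝ}, 0 ≤ M → 0 ≤ N → PiecewiseSmooth S D k M f →
    PiecewiseSmooth S D k N g → PiecewiseSmooth S D k (2 ^ k * (M * N)) (fun x => f x * g x) := by
  induction k with
  | zero =>
    intro M N f g hM hN hf hg x hx
    rw [pow_zero, one_mul, abs_mul]
    exact mul_le_mul (hf x hx) (hg x hx) (abs_nonneg _) hM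
  | succ k ih =>
    intro M N f g hM hN hf hg
    have hf' := hf.of_succ
    have hg' := hg.of_succ
    obtain ⟨f1, f2, f', f3, f4⟩ := hf
    obtain ⟨g1, g2, g', g3, g4⟩ := hg
    refine ⟨fun x hx => ?_, f2.mul g2, _, fun x hx => (f3 x hx).mul (g3 x hx), ?_⟩
    · rw [abs_mul]
      refine (mul_le_mul (f1 x hx) (g1 x hx) (abs_nonneg _) hM).trans ?_
      exact le_mul_of_one_le_left (mul_nonneg hM hN) (one_le_pow₀ one_le_two)
    · rw [show (2 : ℝ) ^ (k + 1) * (M * N) = 2 ^ k * (M * N) + 2 ^ k * (M * N) by ring]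
      exact (ih hM hN f4 hg').add (ih hM hN hf' g4)

lemma const {k : ℕ} : ∀ {M : ℝ} (c : ℝ), |c| ≤ M → PiecewiseSmooth S D k M (fun _ => c) := by
  induction k with
  | zero => exact fun c hc x _ => hc
  | succ k ih =>
    intro M c hc
    exact ⟨fun _ _ => hc, continuous_const, fun _ => 0, fun x _ => hasDerivAt_const x c,
      ih 0 (by rw [abs_zero]; exact (abs_nonneg c).trans hc)⟩

lemma const_mul {k : ℕ} {M : ℝ} {f : ℝ → ℝ} (c : ℝ) (hM : 0 ≤ M)
    (hf : PiecewiseSmooth S D k M f) :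
    PiecewiseSmooth S D k (2 ^ k * (|c| * M)) (fun x => c * f x) :=
  mul (abs_nonneg c) hM (const c le_rfl) hf

lemma sub_const {k : ℕ} {M : ℝ} (c : ℝ) (hM : 1 ≤ M) (hD : ∀ x ∈ D, |x - c| ≤ M) :
    PiecewiseSmooth S D k M (fun x => x - c) := by
  cases k with
  | zero => exact hD
  | succ k =>
    exact ⟨hD, by fun_prop, fun _ => 1, fun x _ => (hasDerivAt_id x).sub_const c,
      const 1 (by rwa [abs_one])⟩

end PiecewiseSmooth

/-- The fundamental theorem of calculus tolerates a countable exceptional set, so `f` is a primitive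
of the continuous function `f'` and is differentiable everywhere. -/
lemma hasDerivAt_of_off_countable {S : Set ℝ} (hS : S.Countable) {f f' : ℝ → ℝ}
    (hf : Continuous f) (hf' : Continuous f') (h : ∀ x, x ∉ S → HasDerivAt f (f' x) x) (x : ℝ) :
    HasDerivAt f (f' x) x := by
  have hF : f = fun y => f 0 + ∫ t in (0 : ℝ)..y, f' t := by
    funext y
    rw [integral_eq_of_hasDerivAt_off_countable f f' hS hf.continuousOn
      (fun z hz => h z hz.2) (hf'.intervalIntegrable _ _)]
    ring
  rw [hF]
  exact (intervalIntegral.integral_hasDerivAt_right (hf'.intervalIntegrable _ _)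
    (hf'.stronglyMeasurableAtFilter _ _) hf'.continuousAt).const_add _

/-- `iteratedDeriv` differentiates globally, whereas `PiecewiseSmooth` provides derivatives off `S`
only. Continuity of all but the top one removes the exceptional points, so that only the last
differentiation may fail on `S`. -/
lemma PiecewiseSmooth.iteratedDeriv_spec {S D : Set ℝ} (hS : S.Countable) {k : ℕ} :
    ∀ {M : ℝ} {f : ℝ → ℝ}, PiecewiseSmooth S D (k + 1) M f →
      Continuous (iteratedDeriv k f) ∧ ∀ x, x ∉ S →
        HasDerivAt (iteratedDeriv k f) (iteratedDeriv (k + 1) f x) x ∧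
        (x ∈ D → |iteratedDeriv (k + 1) f x| ≤ M) := by
  induction k with
  | zero =>
    rintro M f ⟨f1, f2, f', f3, f4⟩
    rw [iteratedDeriv_zero]
    refine ⟨f2, fun x hx => ?_⟩
    rw [zero_add, iteratedDeriv_one, (f3 x hx).deriv]
    exact ⟨f3 x hx, fun hD => f4 x hD⟩
  | succ k ih =>
    rintro M f ⟨f1, f2, f', f3, f4⟩
    have hd : deriv f = f' := funext fun x =>
      (hasDerivAt_of_off_countable hS f2 f4.2.1 f3 x).deriv
    have := ih f4
    rw [iteratedDeriv_succ', iteratedDeriv_succ' (n := k + 1), hd]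
    exact this

/-! ### The transition function -/

lemma piecewiseSmooth_bspline {ξ : ℕ → ℝ} (hξ : StrictMono ξ) (D : Set ℝ) (p : ℕ) :
    ∀ j, ∃ M, 0 ≤ M ∧ PiecewiseSmooth (range ξ) D p M (bspline ξ p j) := by
  induction p with
  | zero =>
    intro j
    obtain ⟨M, hM⟩ := bspline_bounded hξ 0 j
    exact ⟨M, (abs_nonneg _).trans (hM 0), fun x _ => hM x⟩
  | succ p ih =>
    intro j
    obtain ⟨M, hM⟩ := bspline_bounded hξ (p + 1) j
    obtain ⟨M₀, h₀, hM₀⟩ := ih j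
    obtain ⟨M₁, h₁, hM₁⟩ := ih (j + 1)
    have h := ((hM₀.const_mul (1 / (ξ (j + p + 1) - ξ j)) h₀).add
      (hM₁.const_mul (-1 / (ξ (j + p + 2) - ξ (j + 1))) h₁)).const_mul (p + 1 : ℝ) (by positivity)
    refine ⟨max M _, le_trans ((abs_nonneg _).trans (hM 0)) (le_max_left _ _),
      fun x _ => (hM x).trans (le_max_left _ _), continuous_bspline hξ p j, _,
      fun x hx => hasDerivAt_bspline hξ hx p j, h.mono (le_max_right _ _)⟩

/-- The Chebyshev knots, continued to a strictly increasing sequence. -/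
noncomputable def chebyshevExtend (p i : ℕ) : ℝ :=
  if i ≤ p + 1 then chebyshevKnot (p + 1) i else i

lemma chebyshevKnot_lt {m i k : ℕ} (hik : i < k) (hk : k ≤ m) :
    chebyshevKnot m i < chebyshevKnot m k := by
  have hm : (0 : ℝ) < m := by exact_mod_cast (by omega : 0 < m)
  refine neg_lt_neg (Real.cos_lt_cos_of_nonneg_of_le_pi (by positivity) ?_ ?_)
  · rw [div_le_iff₀ hm, mul_comm]
    exact mul_le_mul_of_nonneg_left (by exact_mod_cast hk) Real.pi_pos.le
  · gcongr

lemma chebyshevKnot_zero (m : ℕ) : chebyshevKnot m 0 = -1 := by simp [chebyshevKnot]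

lemma chebyshevKnot_self (p : ℕ) : chebyshevKnot (p + 1) (p + 1) = 1 := by
  have : ((p + 1 : ℕ) : ℝ) ≠ 0 := by positivity
  rw [chebyshevKnot, mul_div_cancel_left₀ _ this, Real.cos_pi, neg_neg]

lemma strictMono_chebyshevExtend (p : ℕ) : StrictMono (chebyshevExtend p) := by
  intro i k hik
  unfold chebyshevExtend
  split_ifs with h1 h2 h2
  · exact chebyshevKnot_lt hik h2
  · have : chebyshevKnot (p + 1) i ≤ 1 := by
      unfold chebyshevKnot
      linarith [Real.neg_one_le_cos ((i : ℝ) * Real.pi / ((p + 1 : ℕ) : ℝ))]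
    exact this.trans_lt (by exact_mod_cast (by omega : 1 < k))
  · omega
  · exact_mod_cast hik

lemma transition_eq (p : ℕ) (x : ℝ) : transition p x =
    ∫ t in (-1 : ℝ)..x, ((p + 1 : ℝ) / 2) * bspline (chebyshevExtend p) p 0 t := by
  rw [transition, bspline_congr (η := chebyshevExtend p) p 0 (fun i _ h => ?_)]
  rw [chebyshevExtend, if_pos (by omega)]

lemma transition_of_le {p : ℕ} {x : ℝ} (hx : x ≤ -1) : transition p x = 0 := by
  rw [transition_eq, intervalIntegral.integral_symm, intervalIntegral.integral_of_le hx,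
    ← integral_Ico_eq_integral_Ioc, setIntegral_eq_zero_of_forall_eq_zero, neg_zero]
  intro t ht
  rw [bspline_eq_zero_of_lt (strictMono_chebyshevExtend p).monotone, mul_zero]
  rw [chebyshevExtend, if_pos (by omega), chebyshevKnot_zero]
  exact ht.2

lemma transition_of_ge {p : ℕ} {x : ℝ} (hx : 1 ≤ x) : transition p x = 1 := by
  have h0 : chebyshevExtend p 0 = -1 := by
    rw [chebyshevExtend, if_pos (by omega), chebyshevKnot_zero]
  have h1 : chebyshevExtend p (0 + p + 1) = 1 := by
    rw [chebyshevExtend, if_pos (by omega), zero_add, chebyshevKnot_self]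
  rw [transition_eq, intervalIntegral.integral_const_mul,
    integral_bspline (strictMono_chebyshevExtend p) p 0 _ _ h0.ge (h1.trans_le hx), h0, h1]
  have : (p + 1 : ℝ) ≠ 0 := by positivity
  field_simp
  norm_num

lemma exists_piecewiseSmooth_transition {p : ℕ} (hp : 1 ≤ p) : ∃ M, 0 ≤ M ∧
    PiecewiseSmooth (range (chebyshevExtend p)) (Icc (-1) 1) (p + 1) M (transition p) := by
  obtain ⟨M, h0, hM⟩ := piecewiseSmooth_bspline (strictMono_chebyshevExtend p) (Icc (-1) 1) p 0
  have hB : Continuous (bspline (chebyshevExtend p) p 0) := by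
    obtain ⟨q, rfl⟩ : ∃ q, p = q + 1 := ⟨p - 1, by omega⟩
    exact continuous_bspline (strictMono_chebyshevExtend _) q 0
  have hc : Continuous fun t => ((p + 1 : ℝ) / 2) * bspline (chebyshevExtend p) p 0 t := by fun_prop
  have hd : ∀ x, HasDerivAt (transition p)
      (((p + 1 : ℝ) / 2) * bspline (chebyshevExtend p) p 0 x) x := by
    intro x
    rw [funext (transition_eq p)]
    exact intervalIntegral.integral_hasDerivAt_right (hc.intervalIntegrable _ _)
      (hc.stronglyMeasurableAtFilter _ _) hc.continuousAt
  have hcont : Continuous (transition p) :=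
    continuous_iff_continuousAt.2 fun x => (hd x).continuousAt
  obtain ⟨N, hN⟩ := (isCompact_Icc (a := (-1 : ℝ)) (b := 1)).exists_bound_of_continuousOn
    hcont.continuousOn
  have h0' := (abs_nonneg _).trans (hN 0 (by norm_num))
  exact ⟨max N _, h0'.trans (le_max_left _ _), fun x hx => (hN x hx).trans (le_max_left _ _), hcont,
    _, fun x _ => hd x, (hM.const_mul _ h0).mono (le_max_right _ _)⟩

/-! ### The dual kernel -/

/-- The point is that `N` is chosen before the nodes `η`: it will not depend on how the interior
knots lie in the support. -/
lemma exists_piecewiseSmooth_prod (S : Set ℝ) (k n : ℕ) : ∃ N : ℝ, 0 ≤ N ∧ ∀ η : ℕ → ℝ,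
    (∀ i < n, |η i| ≤ 1) →
    PiecewiseSmooth S (Icc (-1) 1) k N (fun y => ∏ i ∈ Finset.range n, (y - η i)) := by
  induction n with
  | zero => exact ⟨1, zero_le_one, fun η _ => by simpa using .const 1 (by simp)⟩
  | succ n ih =>
    obtain ⟨N, h0, hN⟩ := ih
    refine ⟨2 ^ k * (N * 2), by positivity, fun η hη => ?_⟩
    simp only [Finset.prod_range_succ]
    refine (hN η fun i hi => hη i (by omega)).mul h0 zero_le_two (.sub_const _ one_le_two ?_)
    intro x hx
    have h1 := abs_le.1 (hη n (by omega))
    rw [abs_le]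
    constructor <;> linarith [hx.1, hx.2]

/-- The dual kernel with support `[-1, 1]` and interior knots `η`. -/
noncomputable def refKernel (p : ℕ) (η : ℕ → ℝ) (y : ℝ) : ℝ :=
  transition p y * ((∏ i ∈ Finset.range p, (y - η i)) * ((p.factorial : ℝ))⁻¹)

lemma exists_piecewiseSmooth_kernel {p : ℕ} (hp : 1 ≤ p) : ∃ N : ℝ, 0 ≤ N ∧ ∀ η : ℕ → ℝ,
    (∀ i < p, |η i| ≤ 1) →
    PiecewiseSmooth (range (chebyshevExtend p)) (Icc (-1) 1) (p + 1) N
      (refKernel p η) := by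
  obtain ⟨M, h0, hM⟩ := exists_piecewiseSmooth_transition hp
  obtain ⟨N, h1, hN⟩ := exists_piecewiseSmooth_prod (range (chebyshevExtend p)) (p + 1) p
  refine ⟨_, ?_, fun η hη => hM.mul h0 ?_ ((hN η hη).mul h1 ?_ (.const _ le_rfl))⟩ <;> positivity

lemma iteratedDeriv_affine_comp (A c d : ℝ) (f : ℝ → ℝ) (n : ℕ) :
    iteratedDeriv n (fun x => A * f (c * x + d)) =
      fun x => A * c ^ n * iteratedDeriv n f (c * x + d) := by
  induction n with
  | zero => simp
  | succ n ih =>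
    funext x
    rw [iteratedDeriv_succ, ih, deriv_const_mul_field, iteratedDeriv_succ]
    have := deriv_comp_mul_left c (fun y => iteratedDeriv n f (y + d)) x
    rw [this, deriv_comp_add_const, smul_eq_mul]
    ring

/-- The affine map of the support onto `[-1, 1]` turns each of the `p` factors `x - ξ_{j+i+1}` into
`2/ℓ` times itself, where `ℓ` is the length of the support; this produces the prefactor `(ℓ/2)^p`.
-/
lemma dualKernel_eq {ξ : ℕ → ℝ} {p j : ℕ} (h : ξ j < ξ (j + p + 1)) :
    dualKernel ξ p j = fun x => ((ξ (j + p + 1) - ξ j) / 2) ^ p *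
      refKernel p (fun i => 2 / (ξ (j + p + 1) - ξ j) * ξ (j + i + 1) +
        -(ξ j + ξ (j + p + 1)) / (ξ (j + p + 1) - ξ j))
      (2 / (ξ (j + p + 1) - ξ j) * x + -(ξ j + ξ (j + p + 1)) / (ξ (j + p + 1) - ξ j)) := by
  funext x
  have hl : ξ (j + p + 1) - ξ j ≠ 0 := by linarith
  have hprod : ∏ i ∈ Finset.range p,
        ((2 / (ξ (j + p + 1) - ξ j) * x + -(ξ j + ξ (j + p + 1)) / (ξ (j + p + 1) - ξ j)) -
        (2 / (ξ (j + p + 1) - ξ j) * ξ (j + i + 1) +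
          -(ξ j + ξ (j + p + 1)) / (ξ (j + p + 1) - ξ j))) =
      (2 / (ξ (j + p + 1) - ξ j)) ^ p * ∏ i ∈ Finset.range p, (x - ξ (j + i + 1)) := by
    calc _ = ∏ i ∈ Finset.range p, (2 / (ξ (j + p + 1) - ξ j)) * (x - ξ (j + i + 1)) :=
          Finset.prod_congr rfl fun i _ => by ring
      _ = _ := by rw [Finset.prod_mul_distrib, Finset.prod_const, Finset.card_range]
  have hone : ((ξ (j + p + 1) - ξ j) / 2) ^ p * (2 / (ξ (j + p + 1) - ξ j)) ^ p = 1 := by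
    rw [← mul_pow, div_mul_div_cancel₀ two_ne_zero, div_self hl, one_pow]
  have harg : 2 / (ξ (j + p + 1) - ξ j) * x + -(ξ j + ξ (j + p + 1)) / (ξ (j + p + 1) - ξ j) =
      (2 * x - ξ j - ξ (j + p + 1)) / (ξ (j + p + 1) - ξ j) := by ring
  simp only [refKernel, hprod]
  rw [dualKernel, harg]
  linear_combination (-transition p ((2 * x - ξ j - ξ (j + p + 1)) / (ξ (j + p + 1) - ξ j)) *
    (∏ i ∈ Finset.range p, (x - ξ (j + i + 1))) * ((p.factorial : ℝ))⁻¹) * hone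

/-- The derivatives of the dual kernel up to order `p` are continuous, the last one has a bounded
derivative off a countable set, and the bound scales with the length of the support. -/
lemma exists_dualKernel_bound {p : ℕ} (hp : 1 ≤ p) : ∃ N : ℝ, 0 ≤ N ∧ ∀ (ξ : ℕ → ℝ) (j : ℕ),
    Monotone ξ → ξ j < ξ (j + p + 1) → ∃ S : Set ℝ, S.Countable ∧
      Continuous (iteratedDeriv (p - 1) (dualKernel ξ p j)) ∧
      Continuous (iteratedDeriv p (dualKernel ξ p j)) ∧
      ∀ x, x ∉ S →
        HasDerivAt (iteratedDeriv (p - 1) (dualKernel ξ p j)) (iteratedDeriv p (dualKernel ξ p j) x) x ∧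
        HasDerivAt (iteratedDeriv p (dualKernel ξ p j)) (iteratedDeriv (p + 1) (dualKernel ξ p j) x) x ∧
        (x ∈ Icc (ξ j) (ξ (j + p + 1)) →
          |iteratedDeriv (p + 1) (dualKernel ξ p j) x| ≤ N / (ξ (j + p + 1) - ξ j)) := by
  obtain ⟨N, h0, hN⟩ := exists_piecewiseSmooth_kernel hp
  refine ⟨2 * N, by positivity, fun ξ j hξ hj => ?_⟩
  have hl : 0 < ξ (j + p + 1) - ξ j := by linarith
  have hmem : ∀ x ∈ Icc (ξ j) (ξ (j + p + 1)), 2 / (ξ (j + p + 1) - ξ j) * x +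
      -(ξ j + ξ (j + p + 1)) / (ξ (j + p + 1) - ξ j) ∈ Icc (-1 : ℝ) 1 := by
    intro x hx
    rw [show 2 / (ξ (j + p + 1) - ξ j) * x + -(ξ j + ξ (j + p + 1)) / (ξ (j + p + 1) - ξ j) =
      (2 * x - ξ j - ξ (j + p + 1)) / (ξ (j + p + 1) - ξ j) by ring]
    exact ⟨(le_div_iff₀ hl).2 (by linarith [hx.1]), (div_le_iff₀ hl).2 (by linarith [hx.2])⟩
  have hη := hN (fun i => 2 / (ξ (j + p + 1) - ξ j) * ξ (j + i + 1) +
      -(ξ j + ξ (j + p + 1)) / (ξ (j + p + 1) - ξ j))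
    (fun i hi => abs_le.2 (hmem _ ⟨hξ (by omega), hξ (by omega)⟩))
  have hS : (range (chebyshevExtend p)).Countable := countable_range _
  obtain ⟨q, rfl⟩ : ∃ q, p = q + 1 := ⟨p - 1, by omega⟩
  obtain ⟨a1, a2⟩ := hη.iteratedDeriv_spec hS
  obtain ⟨b1, b2⟩ := hη.of_succ.iteratedDeriv_spec hS
  rw [dualKernel_eq hj, Nat.add_sub_cancel]
  simp only [iteratedDeriv_affine_comp]
  set c := 2 / (ξ (j + (q + 1) + 1) - ξ j) with hc
  set d := -(ξ j + ξ (j + (q + 1) + 1)) / (ξ (j + (q + 1) + 1) - ξ j)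
  have hcpos : 0 < c := by positivity
  have hinj : Function.Injective fun x : ℝ => c * x + d := fun x y hxy => by
    have : c * x = c * y := by simpa using hxy
    exact mul_left_cancel₀ hcpos.ne' this
  have hlin : ∀ x, HasDerivAt (fun x : ℝ => c * x + d) c x := fun x => by
    simpa using ((hasDerivAt_id x).const_mul c).add_const d
  refine ⟨(fun x : ℝ => c * x + d) ⁻¹' range (chebyshevExtend (q + 1)), hS.preimage hinj,
    ?_, ?_, fun x hx => ⟨?_, ?_, fun hxI => ?_⟩⟩
  · exact continuous_const.mul (b1.comp (by fun_prop : Continuous fun x : ℝ => c * x + d))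
  · exact continuous_const.mul (a1.comp (by fun_prop : Continuous fun x : ℝ => c * x + d))
  · refine (((b2 _ hx).1.comp x (hlin x)).const_mul _).congr_deriv ?_
    ring
  · refine (((a2 _ hx).1.comp x (hlin x)).const_mul _).congr_deriv ?_
    ring
  · have := (a2 _ hx).2 (hmem x hxI)
    -- The prefactor `(ℓ/2)^p` against the factor `(2/ℓ)^{p+1}` from `p + 1` derivatives leaves a
    -- single `2/ℓ`.
    have e : ((ξ (j + (q + 1) + 1) - ξ j) / 2) ^ (q + 1) * c ^ (q + 1 + 1) = c := by
      rw [pow_succ c, ← mul_assoc, ← mul_pow, hc, div_mul_div_cancel₀ two_ne_zero, div_self hl.ne',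
        one_pow, one_mul]
    rw [e, abs_mul, abs_of_pos hcpos]
    calc _ ≤ c * N := mul_le_mul_of_nonneg_left this hcpos.le
      _ = _ := by rw [hc]; ring

/-! ### Boundary values of the dual kernel and moments of the dual functionals. -/

open Polynomial in
-- Only the two leading coefficients of the product survive. After division by `(n + 1)!` the
-- constant term becomes the mean of the roots, which is the source of the Greville point.
lemma iterate_derivative_prod_X_sub_C (η : ℕ → ℝ) (n : ℕ) :
    derivative^[n] (∏ k ∈ Finset.range (n + 1), (X - C (η k))) =
      C ((n + 1).factorial : ℝ) * X - C ((n.factorial : ℝ) * ∑ k ∈ Finset.range (n + 1), η k) := by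
  induction n with
  | zero => simp
  | succ n ih =>
    have h1 : derivative^[n + 1] (∏ k ∈ Finset.range (n + 1), (X - C (η k))) =
        C ((n + 1).factorial : ℝ) := by
      rw [Function.iterate_succ_apply', ih]
      simp
    rw [Finset.prod_range_succ, mul_sub, iterate_derivative_sub, iterate_derivative_mul_X, h1,
      mul_comm _ (C (η (n + 1))), iterate_derivative_C_mul, h1, Nat.add_sub_cancel, ih,
      Finset.sum_range_succ _ (n + 1), Nat.factorial_succ (n + 1)]
    simp only [nsmul_eq_mul, Nat.factorial_succ n]
    push_cast
    simp only [map_mul, map_add, map_natCast, map_one]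
    ring

open Polynomial in
lemma iteratedDeriv_polynomial (P : ℝ[X]) (n : ℕ) :
    iteratedDeriv n (fun x => P.eval x) = fun x => (derivative^[n] P).eval x := by
  induction n with
  | zero => simp
  | succ n ih =>
    rw [iteratedDeriv_succ, ih]
    funext x
    rw [Polynomial.deriv, Function.iterate_succ_apply']

open Polynomial in
/-- The derivatives of order `p - 1` and `p` of the dual kernel right of its support. -/
lemma iteratedDeriv_dualPolynomial {ξ : ℕ → ℝ} {p : ℕ} (hp : 1 ≤ p) (j : ℕ) :
    iteratedDeriv (p - 1) (fun x => (∏ k ∈ Finset.range p, (x - ξ (j + k + 1))) / (p.factorial : ℝ)) =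
      (fun x => x - (∑ k ∈ Finset.range p, ξ (j + k + 1)) / p) ∧
    iteratedDeriv p (fun x => (∏ k ∈ Finset.range p, (x - ξ (j + k + 1))) / (p.factorial : ℝ)) =
      fun _ => 1 := by
  obtain ⟨q, rfl⟩ : ∃ q, p = q + 1 := ⟨p - 1, by omega⟩
  have hfun : (fun x => (∏ k ∈ Finset.range (q + 1), (x - ξ (j + k + 1))) /
      ((q + 1).factorial : ℝ)) = fun x => (C (((q + 1).factorial : ℝ)⁻¹) *
        ∏ k ∈ Finset.range (q + 1), (X - C (ξ (j + k + 1)))).eval x := by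
    funext x
    simp [eval_prod]
    ring
  have hq : ((q.factorial : ℕ) : ℝ) ≠ 0 := by positivity
  have hq1 : (q + 1 : ℝ) ≠ 0 := by positivity
  have h1 : iteratedDeriv (q + 1 - 1) (fun x => (∏ k ∈ Finset.range (q + 1), (x - ξ (j + k + 1))) /
      ((q + 1).factorial : ℝ)) =
      fun x => x - (∑ k ∈ Finset.range (q + 1), ξ (j + k + 1)) / ((q + 1 : ℕ) : ℝ) := by
    rw [hfun, iteratedDeriv_polynomial, Nat.add_sub_cancel]
    funext x
    rw [iterate_derivative_C_mul, iterate_derivative_prod_X_sub_C, Nat.factorial_succ]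
    simp only [eval_mul, eval_C, eval_sub, eval_X]
    push_cast
    field_simp
  refine ⟨h1, ?_⟩
  rw [Nat.add_sub_cancel] at h1
  rw [iteratedDeriv_succ, h1]
  funext x
  simp

/-- The transition function is `0` left of the support, so the kernel vanishes there; continuity
carries the value to the end point. -/
lemma iteratedDeriv_dualKernel_left {ξ : ℕ → ℝ} {p j n : ℕ} (h : ξ j < ξ (j + p + 1))
    (hc : Continuous (iteratedDeriv n (dualKernel ξ p j))) :
    iteratedDeriv n (dualKernel ξ p j) (ξ j) = 0 := by
  have h1 : EqOn (dualKernel ξ p j) (fun _ => 0) (Iio (ξ j)) := by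
    intro x hx
    have hx : x < ξ j := hx
    rw [dualKernel, transition_of_le, zero_mul]
    rw [div_le_iff₀ (by linarith)]
    linarith
  have h2 := h1.iteratedDeriv_of_isOpen isOpen_Iio n
  have h0 : iteratedDeriv n (fun _ : ℝ => (0 : ℝ)) = fun _ => 0 := by
    funext x; simp
  rw [h0] at h2
  have h3 := h2.closure hc continuous_const
  rw [closure_Iio] at h3
  exact h3 self_mem_Iic

/-- Right of the support the transition function is `1` and the kernel is the polynomial factor
alone; again continuity reaches the end point. -/
lemma iteratedDeriv_dualKernel_right {ξ : ℕ → ℝ} {p j n : ℕ} (h : ξ j < ξ (j + p + 1))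
    (hc : Continuous (iteratedDeriv n (dualKernel ξ p j))) {f : ℝ → ℝ} (hf : Continuous f)
    (hn : iteratedDeriv n
      (fun x => (∏ k ∈ Finset.range p, (x - ξ (j + k + 1))) / (p.factorial : ℝ)) = f) :
    iteratedDeriv n (dualKernel ξ p j) (ξ (j + p + 1)) = f (ξ (j + p + 1)) := by
  have h1 : EqOn (dualKernel ξ p j)
      (fun x => (∏ k ∈ Finset.range p, (x - ξ (j + k + 1))) / (p.factorial : ℝ))
      (Ioi (ξ (j + p + 1))) := by
    intro x hx
    have hx : ξ (j + p + 1) < x := hx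
    rw [dualKernel, transition_of_ge, one_mul]
    rw [le_div_iff₀ (by linarith)]
    linarith
  have h2 := h1.iteratedDeriv_of_isOpen isOpen_Ioi n
  rw [hn] at h2
  have h3 := h2.closure hc hf
  rw [closure_Ioi] at h3
  exact h3 self_mem_Ici

lemma measurable_iteratedDeriv_succ (f : ℝ → ℝ) (n : ℕ) : Measurable (iteratedDeriv (n + 1) f) := by
  rw [iteratedDeriv_succ]
  exact measurable_deriv _

/-- The dual functionals on constants and on the identity. -/
lemma dualFunctional_one_id {ξ : ℕ → ℝ} {p j : ℕ} (hp : 1 ≤ p) (hξ : Monotone ξ)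
    (h : ξ j < ξ (j + p + 1)) :
    dualFunctional ξ p j (fun _ => 1) = 1 ∧
    dualFunctional ξ p j (fun s => s) = (∑ k ∈ Finset.range p, ξ (j + k + 1)) / p := by
  obtain ⟨N, h0, hN⟩ := exists_dualKernel_bound hp
  obtain ⟨S, hS, c0, c1, hd⟩ := hN ξ j hξ h
  have hl : 0 < ξ (j + p + 1) - ξ j := by linarith
  obtain ⟨e0, e1⟩ := iteratedDeriv_dualPolynomial (ξ := ξ) hp j
  have l0 := iteratedDeriv_dualKernel_left h c0
  have l1 := iteratedDeriv_dualKernel_left h c1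
  have r0 := iteratedDeriv_dualKernel_right h c0 (by fun_prop) e0
  have r1 := iteratedDeriv_dualKernel_right h c1 (by fun_prop) e1
  have hint : IntervalIntegrable (iteratedDeriv (p + 1) (dualKernel ξ p j)) volume (ξ j)
      (ξ (j + p + 1)) := by
    refine (intervalIntegrable_const (c := N / (ξ (j + p + 1) - ξ j))).mono_fun
      (measurable_iteratedDeriv_succ _ _).aestronglyMeasurable ?_
    rw [uIoc_of_le h.le]
    have : ∀ᵐ x ∂volume.restrict (Ioc (ξ j) (ξ (j + p + 1))), x ∉ S :=
      ae_restrict_of_ae (hS.ae_notMem volume)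
    filter_upwards [this, ae_restrict_mem measurableSet_Ioc] with x hx hxI
    exact ((hd x hx).2.2 (Ioc_subset_Icc_self hxI)).trans (le_abs_self _)
  have hint0 := c1.intervalIntegrable (μ := volume) (ξ j) (ξ (j + p + 1))
  have hintid : IntervalIntegrable
      (fun s => s * iteratedDeriv (p + 1) (dualKernel ξ p j) s) volume (ξ j)
      (ξ (j + p + 1)) := hint.continuousOn_mul continuousOn_id
  have i1 := integral_eq_of_hasDerivAt_off_countable _ _ hS c1.continuousOn
    (fun x hx => (hd x hx.2).2.1) hint
  have i0 := integral_eq_of_hasDerivAt_off_countable _ _ hS c0.continuousOn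
    (fun x hx => (hd x hx.2).1) hint0
  -- Integration by parts: with `ψ` the kernel and `e` the right end of the support, `∫ s D^{p+1}ψ =
  -- e · D^pψ(e) - D^{p-1}ψ(e) = e - (e - mean)`, the boundary terms on the left being zero.
  have i2 := integral_eq_of_hasDerivAt_off_countable
    (fun s => s * iteratedDeriv p (dualKernel ξ p j) s)
    (fun s => iteratedDeriv p (dualKernel ξ p j) s +
      s * iteratedDeriv (p + 1) (dualKernel ξ p j) s) hS (by fun_prop)
    (fun x hx => ((hasDerivAt_id x).mul (hd x hx.2).2.1).congr_deriv (by simp))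
    (hint0.add hintid)
  rw [intervalIntegral.integral_add hint0 hintid, i0, r0, r1, l0, l1] at i2
  rw [r1, l1] at i1
  constructor
  · simp only [dualFunctional, one_mul]
    rw [i1, sub_zero]
  · simp only [dualFunctional]
    linarith

/-! ### Functionals given by a bounded density -/

/-- A common interval `(a, b)` is allowed so that all functionals active on one element have
densities over the same support extension. -/
lemma exists_dualFunctional_density {p : ℕ} (hp : 1 ≤ p) : ∃ N : ℝ, 0 ≤ N ∧
    ∀ (ξ : ℕ → ℝ) (j : ℕ) (a b : ℝ), Monotone ξ → ξ j < ξ (j + p + 1) → a ≤ ξ j →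
      ξ (j + p + 1) ≤ b → ∃ κ : ℝ → ℝ, Measurable κ ∧
        (∀ s, |κ s| ≤ N / (ξ (j + p + 1) - ξ j)) ∧
        ∀ v : ℝ → ℝ, dualFunctional ξ p j v = ∫ s in Ioo a b, κ s * v s := by
  obtain ⟨N, h0, hN⟩ := exists_dualKernel_bound hp
  refine ⟨N, h0, fun ξ j a b hξ hj ha hb => ?_⟩
  obtain ⟨S, hS, -, -, hd⟩ := hN ξ j hξ hj
  have hl : 0 < ξ (j + p + 1) - ξ j := by linarith
  set D := iteratedDeriv (p + 1) (dualKernel ξ p j) with hD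
  have hDm : Measurable D := measurable_iteratedDeriv_succ _ _
  -- The derivative is controlled only off a countable set. Cutting it off where the bound fails
  -- changes no integral and makes the bound hold everywhere.
  set E : Set ℝ := Ioo (ξ j) (ξ (j + p + 1)) ∩ {s | |D s| ≤ N / (ξ (j + p + 1) - ξ j)} with hE
  have hEm : MeasurableSet E := measurableSet_Ioo.inter
    (measurableSet_le (by simpa using hDm.norm) measurable_const)
  refine ⟨E.indicator D, hDm.indicator hEm, fun s => ?_, fun v => ?_⟩
  · by_cases hs : s ∈ E
    · rw [indicator_of_mem hs]; exact hs.2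
    · rw [indicator_of_notMem hs, abs_zero]; positivity
  · rw [dualFunctional, intervalIntegral.integral_of_le hj.le, integral_Ioc_eq_integral_Ioo,
      setIntegral_eq_of_subset_of_forall_sdiff_eq_zero measurableSet_Ioo (Ioo_subset_Ioo ha hb)]
    · refine setIntegral_congr_ae measurableSet_Ioo ?_
      filter_upwards [hS.ae_notMem volume] with s hs hsI
      have hsE : s ∈ E := ⟨hsI, (hd s hs).2.2 (Ioo_subset_Icc_self hsI)⟩
      rw [indicator_of_mem hsE, mul_comm]
    · intro s hs
      rw [indicator_of_notMem (fun h : s ∈ E => hs.2 h.1), zero_mul]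

/-- The density of `u ↦ ∫_a^b κ(s) (∫_a^s u) ds`. -/
noncomputable def primitiveDensity (a b : ℝ) (κ : ℝ → ℝ) : ℝ → ℝ :=
  (Ioo a b).indicator (fun t => ∫ s in t..b, κ s)

lemma integrableOn_Ioo_of_bounded {a b M : ℝ} {κ : ℝ → ℝ} (hκ : Measurable κ)
    (hM : ∀ s, |κ s| ≤ M) : IntegrableOn κ (Ioo a b) :=
  Measure.integrableOn_of_bounded (M := M) (by simp) hκ.aestronglyMeasurable
    (Filter.Eventually.of_forall hM)

lemma intervalIntegrable_of_bounded {a b M : ℝ} {κ : ℝ → ℝ} (hκ : Measurable κ)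
    (hM : ∀ s, |κ s| ≤ M) : IntervalIntegrable κ volume a b :=
  (intervalIntegrable_const (c := M)).mono_fun hκ.aestronglyMeasurable
    (Filter.Eventually.of_forall fun x => (hM x).trans (le_abs_self M))

lemma measurable_primitiveDensity {a b M : ℝ} {κ : ℝ → ℝ} (hκ : Measurable κ)
    (hM : ∀ s, |κ s| ≤ M) : Measurable (primitiveDensity a b κ) := by
  refine Measurable.indicator ?_ measurableSet_Ioo
  have h : Continuous fun t => ∫ s in b..t, κ s :=
    intervalIntegral.continuous_primitive (fun _ _ => intervalIntegrable_of_bounded hκ hM) b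
  have : (fun t => ∫ s in t..b, κ s) = fun t => -∫ s in b..t, κ s :=
    funext fun t => intervalIntegral.integral_symm b t
  rw [this]
  exact h.neg.measurable

lemma abs_primitiveDensity_le {a b M : ℝ} (hab : a ≤ b) {κ : ℝ → ℝ} (hM : ∀ s, |κ s| ≤ M) (t : ℝ) :
    |primitiveDensity a b κ t| ≤ M * (b - a) := by
  have h0 : 0 ≤ M := (abs_nonneg _).trans (hM 0)
  rw [primitiveDensity]
  by_cases ht : t ∈ Ioo a b
  · rw [indicator_of_mem ht]
    have := intervalIntegral.norm_integral_le_of_norm_le_const (a := t) (b := b) (f := κ) (C := M)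
      (fun x _ => hM x)
    refine this.trans (mul_le_mul_of_nonneg_left ?_ h0)
    rw [abs_of_nonneg (by linarith [ht.2])]
    linarith [ht.1]
  · rw [indicator_of_notMem ht, abs_zero]
    exact mul_nonneg h0 (by linarith)

/-- Fubini on the triangle `a < t ≤ s < b`. -/
lemma integral_mul_primitive {a b M : ℝ} {κ u : ℝ → ℝ} (hκ : Measurable κ)
    (hM : ∀ s, |κ s| ≤ M) (hu : IntegrableOn u (Ioo a b)) :
    ∫ s in Ioo a b, κ s * ∫ t in a..s, u t = ∫ t in Ioo a b, primitiveDensity a b κ t * u t := by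
  set F : ℝ → ℝ → ℝ := fun s t => {z : ℝ × ℝ | z.2 ≤ z.1}.indicator (fun z => κ z.1 * u z.2) (s, t)

  have hFle : ∀ s t, t ≤ s → F s t = κ s * u t := fun s t hst =>
    indicator_of_mem (s := {z : ℝ × ℝ | z.2 ≤ z.1}) (a := (s, t)) hst _
  have hFlt : ∀ s t, ¬ t ≤ s → F s t = 0 := fun s t hst =>
    indicator_of_notMem (s := {z : ℝ × ℝ | z.2 ≤ z.1}) (a := (s, t)) hst _
  have hint : Integrable (Function.uncurry F)
      ((volume.restrict (Ioo a b)).prod (volume.restrict (Ioo a b))) :=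
    (Integrable.mul_prod (integrableOn_Ioo_of_bounded hκ hM) hu).indicator
      (measurableSet_le measurable_snd measurable_fst)
  have h1 : ∀ s ∈ Ioo a b, κ s * ∫ t in a..s, u t = ∫ t in Ioo a b, F s t := by
    intro s hs
    rw [intervalIntegral.integral_of_le hs.1.le, ← integral_const_mul,
      setIntegral_eq_of_subset_of_forall_sdiff_eq_zero measurableSet_Ioo
        (show Ioc a s ⊆ Ioo a b from fun t ht => ⟨ht.1, ht.2.trans_lt hs.2⟩)]
    · refine setIntegral_congr_fun measurableSet_Ioc fun t ht => ?_
      exact (hFle s t ht.2).symm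
    · intro t ht
      exact hFlt s t fun h => ht.2 ⟨ht.1.1, h⟩
  have h2 : ∀ t ∈ Ioo a b, primitiveDensity a b κ t * u t = ∫ s in Ioo a b, F s t := by
    intro t ht
    rw [primitiveDensity, indicator_of_mem ht, intervalIntegral.integral_of_le ht.2.le,
      integral_Ioc_eq_integral_Ioo, ← integral_Ico_eq_integral_Ioo, ← integral_mul_const,
      setIntegral_eq_of_subset_of_forall_sdiff_eq_zero measurableSet_Ioo
        (show Ico t b ⊆ Ioo a b from fun s hs => ⟨ht.1.trans_le hs.1, hs.2⟩)]
    · refine setIntegral_congr_fun measurableSet_Ico fun s hs => ?_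
      exact (hFle s t hs.1).symm
    · intro s hs
      exact hFlt s t fun h => hs.2 ⟨h, hs.1.2⟩
  rw [setIntegral_congr_fun measurableSet_Ioo h1, setIntegral_congr_fun measurableSet_Ioo h2]
  exact integral_integral_swap hint

lemma integrableOn_primitive {a b : ℝ} (hab : a ≤ b) {u : ℝ → ℝ} (hu : IntegrableOn u (Ioo a b)) :
    IntegrableOn (fun s => ∫ t in a..s, u t) (Ioo a b) := by
  have h : IntegrableOn u (uIcc a b) := by
    rw [uIcc_of_le hab]; exact (integrableOn_Icc_iff_integrableOn_Ioo).2 hu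
  have := intervalIntegral.continuousOn_primitive_interval h
  rw [uIcc_of_le hab] at this
  exact this.integrableOn_Icc.mono_set Ioo_subset_Icc_self

/-- The action of a density on an affine function plus a primitive. -/
lemma integral_density_affine_add_primitive {a b M c d : ℝ} (hab : a ≤ b) {κ u w : ℝ → ℝ}
    (hκ : Measurable κ) (hM : ∀ s, |κ s| ≤ M) (hu : IntegrableOn u (Ioo a b))
    (hw : ∀ s ∈ Ioo a b, w s = d * 1 + c * s + ∫ t in a..s, u t) :
    ∫ s in Ioo a b, κ s * w s = d * (∫ s in Ioo a b, κ s * 1) + c * (∫ s in Ioo a b, κ s * s) +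
      ∫ t in Ioo a b, primitiveDensity a b κ t * u t := by
  have hmul : ∀ g : ℝ → ℝ, IntegrableOn g (Ioo a b) →
      IntegrableOn (fun s => κ s * g s) (Ioo a b) := fun g hg =>
    Integrable.bdd_mul hg hκ.aestronglyMeasurable (Filter.Eventually.of_forall hM)
  have i0 := hmul (fun _ => 1) (by simp)
  have i1 := hmul (fun s => s) (continuousOn_id.integrableOn_Icc.mono_set Ioo_subset_Icc_self)
  have i2 := hmul _ (integrableOn_primitive hab hu)
  have i0' : IntegrableOn (fun s => d * (κ s * 1)) (Ioo a b) := i0.const_mul d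
  have i1' : IntegrableOn (fun s => c * (κ s * s)) (Ioo a b) := i1.const_mul c
  have i01 : IntegrableOn (fun s => d * (κ s * 1) + c * (κ s * s)) (Ioo a b) := i0'.add i1'
  rw [← integral_mul_primitive hκ hM hu, ← integral_const_mul, ← integral_const_mul,
    ← integral_add i0' i1', ← integral_add i01 i2]
  refine setIntegral_congr_fun measurableSet_Ioo fun s hs => ?_
  simp only [hw s hs]
  ring

/-! ### Elements of an open knot vector -/

namespace OpenKnots

variable {p : ℕ} {Ξ : OpenKnots p} {m : ℕ}

lemma IsElement.le (h : Ξ.IsElement m) : p ≤ m := by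
  by_contra hm
  have h1 := Ξ.knot_start m (by omega)
  have h2 := Ξ.knot_start (m + 1) (by omega)
  unfold IsElement at h
  linarith

lemma IsElement.lt (h : Ξ.IsElement m) : m < Ξ.n := by
  by_contra hm
  have h1 := Ξ.knot_end m (by omega)
  have h2 := Ξ.knot_end (m + 1) (by omega)
  unfold IsElement at h
  linarith

lemma knot_nonneg (Ξ : OpenKnots p) (i : ℕ) : 0 ≤ Ξ.knot i :=
  (Ξ.knot_start 0 (Nat.zero_le _)).ge.trans (Ξ.mono (Nat.zero_le i))

lemma knot_le_one (Ξ : OpenKnots p) (i : ℕ) : Ξ.knot i ≤ 1 :=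
  (Ξ.mono (Nat.le_add_right i Ξ.n)).trans (Ξ.knot_end _ (Nat.le_add_left _ _)).le

/-- Telescoping over `k` knot spans: a nonempty one is bounded by regularity, an empty one
contributes zero. -/
lemma IsRegular.sub_le {c : ℝ} (hc : Ξ.IsRegular c) (h : Ξ.IsElement m) (i k : ℕ) :
    Ξ.knot (i + k) - Ξ.knot i ≤ k * (c * (Ξ.knot (m + 1) - Ξ.knot m)) := by
  have hm : 0 < Ξ.knot (m + 1) - Ξ.knot m := sub_pos.2 h
  have h0 := hm.le.trans (hc m m h h)
  induction k with
  | zero => simp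
  | succ k ih =>
    have h1 : Ξ.knot (i + k + 1) - Ξ.knot (i + k) ≤ c * (Ξ.knot (m + 1) - Ξ.knot m) := by
      by_cases hk : Ξ.IsElement (i + k)
      · exact hc m (i + k) h hk
      · have : ¬ Ξ.knot (i + k) < Ξ.knot (i + k + 1) := hk
        linarith
    push_cast
    rw [← add_assoc]
    linarith

end OpenKnots

/-! ### Univariate projections as integral operators -/

/-- On `I`, the operator `T` is an integral operator over `J` with a kernel bounded by `A`. -/
def IsKernelOp (T : (ℝ → ℝ) → ℝ → ℝ) (I J : Set ℝ) (A : ℝ) : Prop :=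
  ∃ K : ℝ × ℝ → ℝ, Measurable K ∧ (∀ x ∈ I, ∀ s, |K (x, s)| ≤ A) ∧
    ∀ v : ℝ → ℝ, IntegrableOn v (Ioo 0 1) → ∀ x ∈ I, T v x = ∫ s in J, K (x, s) * v s

lemma isKernelOp_of_sum {T : (ℝ → ℝ) → ℝ → ℝ} {I : Set ℝ} {a b M N : ℝ} (s : Finset ℕ)
    {κ β : ℕ → ℝ → ℝ} (h0 : 0 ≤ a) (h1 : b ≤ 1) (hκ : ∀ j ∈ s, Measurable (κ j))
    (hM : ∀ j ∈ s, ∀ t, |κ j t| ≤ M) (hβ : ∀ j ∈ s, Measurable (β j))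
    (hN : ∀ j ∈ s, ∀ x ∈ I, |β j x| ≤ N)
    (hT : ∀ v : ℝ → ℝ, IntegrableOn v (Ioo 0 1) → ∀ x ∈ I,
      T v x = ∑ j ∈ s, (∫ t in Ioo a b, κ j t * v t) * β j x) :
    IsKernelOp T I (Ioo a b) (s.card * (M * N)) := by
  refine ⟨fun z => ∑ j ∈ s, κ j z.2 * β j z.1, ?_, ?_, ?_⟩
  · exact Finset.measurable_sum _ fun j hj =>
      ((hκ j hj).comp measurable_snd).mul ((hβ j hj).comp measurable_fst)
  · intro x hx t
    refine (Finset.abs_sum_le_sum_abs _ _).trans ?_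
    rw [← nsmul_eq_mul]
    refine Finset.sum_le_card_nsmul _ _ _ fun j hj => ?_
    rw [abs_mul]
    exact mul_le_mul (hM j hj t) (hN j hj x hx) (abs_nonneg _) ((abs_nonneg _).trans (hM j hj t))
  · intro v hv x hx
    rw [hT v hv x hx]
    have hv' : IntegrableOn v (Ioo a b) := hv.mono_set (Ioo_subset_Ioo h0 h1)
    simp only [Finset.sum_mul]
    rw [integral_finsetSum]
    · refine Finset.sum_congr rfl fun j _ => ?_
      rw [← integral_mul_const]
      refine integral_congr_ae (Filter.Eventually.of_forall fun t => ?_)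
      simp only
      ring
    · intro j hj
      have : Integrable (fun t => κ j t * v t) (volume.restrict (Ioo a b)) :=
        Integrable.bdd_mul hv' (hκ j hj).aestronglyMeasurable (Filter.Eventually.of_forall (hM j hj))
      refine (this.mul_const (β j x)).congr (Filter.Eventually.of_forall fun t => ?_)
      simp only
      ring

/-- Differentiation is local, so the representation of `f` is needed on the open set `I` only.
Besides splines, it will be applied to `1` and `x`, where it gives the identities that annihilate
the nonlocal terms. -/
lemma deriv_eq_sum {I : Set ℝ} (hI : IsOpen I) {h M : ℝ} (s : Finset ℕ) {β : ℕ → ℝ → ℝ}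
    (hβ : ∀ j, ScaledC2 I h M (β j)) {c : ℕ → ℝ} {f : ℝ → ℝ}
    (hf : ∀ x ∈ I, f x = ∑ j ∈ s, c j * β j x) :
    (∀ x ∈ I, deriv f x = ∑ j ∈ s, c j * deriv (β j) x) ∧
      ∀ x ∈ I, deriv (deriv f) x = ∑ j ∈ s, c j * deriv (deriv (β j)) x := by
  have h1 : ∀ x ∈ I, deriv f x = ∑ j ∈ s, c j * deriv (β j) x := by
    intro x hx
    have he : f =ᶠ[nhds x] fun y => ∑ j ∈ s, c j * β j y := by
      filter_upwards [hI.mem_nhds hx] with y hy using hf y hy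
    rw [he.deriv_eq]
    exact (HasDerivAt.fun_sum fun j _ =>
      (((hβ j).deriv_spec hI hx).1.hasDerivAt.const_mul (c j))).deriv
  refine ⟨h1, fun x hx => ?_⟩
  have he : deriv f =ᶠ[nhds x] fun y => ∑ j ∈ s, c j * deriv (β j) y := by
    filter_upwards [hI.mem_nhds hx] with y hy using h1 y hy
  rw [he.deriv_eq]
  exact (HasDerivAt.fun_sum fun j _ =>
    (((hβ j).deriv_spec hI hx).2.1.hasDerivAt.const_mul (c j))).deriv

lemma intervalIntegrable_of_integrableOn_unit {v : ℝ → ℝ} (hv : IntegrableOn v (Ioo 0 1)) {s t : ℝ}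
    (hs : s ∈ Icc (0 : ℝ) 1) (ht : t ∈ Icc (0 : ℝ) 1) : IntervalIntegrable v volume s t := by
  have : IntegrableOn v (Icc 0 1) := (integrableOn_Icc_iff_integrableOn_Ioo).2 hv
  exact (this.mono_set (uIcc_subset_Icc hs ht)).intervalIntegrable

/-- The three univariate projections are integral operators on each element, with kernels of the
size of the inverse of the mesh width. -/
theorem exists_isKernelOp {p : ℕ} (hp : 1 ≤ p) (cu : ℝ) : ∃ C : ℝ, 0 ≤ C ∧ ∀ Ξ : OpenKnots p,
    Ξ.IsRegular cu → ∀ m, Ξ.IsElement m → ∃ A : ℝ, 0 ≤ A ∧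
      A * (Ξ.knot (m + p + 1) - Ξ.knot (m - p)) ≤ C ∧
      ∀ T ∈ ({proj Ξ, projC1 Ξ, projC2 Ξ} : Set ((ℝ → ℝ) → ℝ → ℝ)),
        IsKernelOp T (Ioo (Ξ.knot m) (Ξ.knot (m + 1)))
          (Ioo (Ξ.knot (m - p)) (Ξ.knot (m + p + 1))) A := by
  obtain ⟨N, hN0, hN⟩ := exists_dualFunctional_density hp
  -- The support extension consists of `2p + 1` knot spans, so `b - a ≤ R h`. Taking `R ≥ 1` lets
  -- `R²` dominate the powers `R^i`, `i ≤ 2`, of all three projections.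
  set R : ℝ := max ((2 * p + 1) * cu) 1 with hR
  have hR1 : 1 ≤ R := le_max_right _ _
  have hR0 : 0 ≤ R := zero_le_one.trans hR1
  refine ⟨(p + 1) * N * 6 ^ p * R ^ 3, by positivity, fun Ξ hreg m hm => ?_⟩
  set ξ := Ξ.knot with hξdef
  have hmono : Monotone ξ := Ξ.mono
  have hpm : p ≤ m := hm.le
  have hmn : m < Ξ.n := hm.lt
  have hm' : ξ m < ξ (m + 1) := hm
  set h := ξ (m + 1) - ξ m with hh
  have hpos : 0 < h := by linarith
  set I := Ioo (ξ m) (ξ (m + 1)) with hI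
  have hIo : IsOpen I := isOpen_Ioo
  set a := ξ (m - p) with ha
  set b := ξ (m + p + 1) with hb
  have hab : a ≤ b := hmono (by omega)
  have ha0 : 0 ≤ a := Ξ.knot_nonneg _
  have hb1 : b ≤ 1 := Ξ.knot_le_one _
  have hJ : b - a ≤ R * h := by
    have := hreg.sub_le hm (m - p) (2 * p + 1)
    rw [show m - p + (2 * p + 1) = m + p + 1 by omega] at this
    refine this.trans ?_
    push_cast
    rw [← mul_assoc]
    exact mul_le_mul_of_nonneg_right (le_max_left _ _) hpos.le
  set s := Finset.Icc (m - p) m with hs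
  have hcard : (s.card : ℝ) = p + 1 := by
    rw [hs, Nat.card_Icc, show m + 1 - (m - p) = p + 1 by omega]
    push_cast
    ring
  have hC2 : ∀ j, ScaledC2 I h (6 ^ p) (bspline ξ p j) := scaledC2_bspline hmono hm' p
  have hsj : ∀ j ∈ s, ξ j ≤ ξ m ∧ ξ (m + 1) ≤ ξ (j + p + 1) ∧ a ≤ ξ j ∧ ξ (j + p + 1) ≤ b := by
    intro j hj
    rw [hs, Finset.mem_Icc] at hj
    exact ⟨hmono hj.2, hmono (by omega), hmono hj.1, hmono (by omega)⟩
  have hdens : ∀ j ∈ s, ∃ κ : ℝ → ℝ, Measurable κ ∧ (∀ t, |κ t| ≤ N / h) ∧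
      ∀ v : ℝ → ℝ, dualFunctional ξ p j v = ∫ t in Ioo a b, κ t * v t := by
    intro j hj
    obtain ⟨k1, k2, k3, k4⟩ := hsj j hj
    obtain ⟨κ, c1, c2, c3⟩ := hN ξ j a b hmono (by linarith) k3 k4
    exact ⟨κ, c1, fun t => (c2 t).trans (div_le_div_of_nonneg_left hN0 hpos (by linarith)), c3⟩
  choose! κ hκm hκb hκ using hdens
  have hone : ∀ j ∈ s, ∫ t in Ioo a b, κ j t * 1 = 1 := by
    intro j hj
    obtain ⟨k1, k2, k3, k4⟩ := hsj j hj
    rw [← hκ j hj (fun _ => 1)]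
    exact (dualFunctional_one_id hp hmono (by linarith)).1
  set G : ℕ → ℝ := fun j => (∑ k ∈ Finset.range p, ξ (j + k + 1)) / p with hG
  have hid : ∀ j ∈ s, ∫ t in Ioo a b, κ j t * t = G j := by
    intro j hj
    obtain ⟨k1, k2, k3, k4⟩ := hsj j hj
    rw [← hκ j hj (fun t => t)]
    exact (dualFunctional_one_id hp hmono (by linarith)).2
  -- only the B-splines in `s` live on the element
  have hrestrict : ∀ (c : ℕ → ℝ), ∀ x ∈ I, ∑ j ∈ Finset.range Ξ.n, c j * bspline ξ p j x =
      ∑ j ∈ s, c j * bspline ξ p j x := by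
    intro c x hx
    symm
    refine Finset.sum_subset (fun j hj => ?_) fun j _ hj => ?_
    · rw [hs, Finset.mem_Icc] at hj
      exact Finset.mem_range.2 (by omega)
    · rw [hs, Finset.mem_Icc] at hj
      rcases lt_or_ge m j with hlt | hge
      · rw [bspline_eq_zero_of_lt hmono p j (hx.2.trans_le (hmono (by omega))), mul_zero]
      · rw [bspline_eq_zero_of_ge hmono p j ((hmono (by omega)).trans hx.1.le), mul_zero]
  -- Differentiated partition of unity: the first and the second derivatives of the active B-splines
  -- sum to zero.
  have hunit := deriv_eq_sum hIo s hC2 (c := fun _ => 1) (f := fun _ => 1) (fun x hx => by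
    rw [← hrestrict _ x hx]
    simp only [one_mul]
    exact (sum_bspline hmono (Ioo_subset_Ico_self hx) hmn p hpm).symm)
  -- Differentiated linear precision: the second derivatives weighted by the Greville points sum to
  -- zero.
  have hlin := deriv_eq_sum hIo s hC2 (c := G) (f := fun x => x) (fun x hx => by
    rw [← hrestrict _ x hx]
    have h1 := sum_greville_bspline hmono (Ioo_subset_Ico_self hx) hmn p hpm
    have hp0 : (p : ℝ) ≠ 0 := by positivity
    simp only [hG, div_mul_eq_mul_div]
    rw [← Finset.sum_div, h1, mul_div_cancel_left₀ _ hp0])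
  have hproj : ∀ w : ℝ → ℝ, ∀ x ∈ I,
      proj Ξ w x = ∑ j ∈ s, (∫ t in Ioo a b, κ j t * w t) * bspline ξ p j x := by
    intro w x hx
    rw [proj, hrestrict _ x hx]
    exact Finset.sum_congr rfl fun j hj => by rw [hκ j hj]
  have hmem : ∀ t ∈ Ioo a b, t ∈ Icc (0 : ℝ) 1 := fun t ht =>
    ⟨ha0.trans ht.1.le, ht.2.le.trans hb1⟩
  have hamem : a ∈ Icc (0 : ℝ) 1 := ⟨ha0, hab.trans hb1⟩
  have h0mem : (0 : ℝ) ∈ Icc (0 : ℝ) 1 := ⟨le_rfl, zero_le_one⟩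
  have hκ1m : ∀ j ∈ s, Measurable (primitiveDensity a b (κ j)) := fun j hj =>
    measurable_primitiveDensity (hκm j hj) (hκb j hj)
  have hκ1b : ∀ j ∈ s, ∀ t, |primitiveDensity a b (κ j) t| ≤ N / h * (b - a) := fun j hj =>
    abs_primitiveDensity_le hab (hκb j hj)
  have hκ2m : ∀ j ∈ s, Measurable (primitiveDensity a b (primitiveDensity a b (κ j))) :=
    fun j hj => measurable_primitiveDensity (hκ1m j hj) (hκ1b j hj)
  have hκ2b : ∀ j ∈ s, ∀ t, |primitiveDensity a b (primitiveDensity a b (κ j)) t| ≤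
      N / h * (b - a) * (b - a) := fun j hj => abs_primitiveDensity_le hab (hκ1b j hj)
  have hsubset : Ioo a b ⊆ Ioo 0 1 := Ioo_subset_Ioo ha0 hb1
  have hsplit : ∀ v : ℝ → ℝ, IntegrableOn v (Ioo 0 1) → ∀ x ∈ Ioo a b,
      ∫ t in (0 : ℝ)..x, v t = (∫ t in (0 : ℝ)..a, v t) + ∫ t in a..x, v t := fun v hv x hx =>
    (intervalIntegral.integral_add_adjacent_intervals
      (intervalIntegrable_of_integrableOn_unit hv h0mem hamem)
      (intervalIntegrable_of_integrableOn_unit hv hamem (hmem x hx))).symm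
  -- The nonlocal part of the primitive enters every coefficient as the same number, because each
  -- functional takes the value `1` on constants.
  have hprim : ∀ v : ℝ → ℝ, IntegrableOn v (Ioo 0 1) → ∀ j ∈ s,
      ∫ t in Ioo a b, κ j t * (∫ y in (0 : ℝ)..t, v y) = (∫ t in (0 : ℝ)..a, v t) +
        ∫ t in Ioo a b, primitiveDensity a b (κ j) t * v t := by
    intro v hv j hj
    rw [integral_density_affine_add_primitive hab (c := 0) (d := ∫ t in (0 : ℝ)..a, v t)
      (hκm j hj) (hκb j hj) (hv.mono_set hsubset) (fun x hx => by rw [hsplit v hv x hx]; ring),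
      hone j hj]
    ring
  have hprim2 : ∀ v : ℝ → ℝ, IntegrableOn v (Ioo 0 1) → ∃ c d : ℝ, ∀ j ∈ s,
      ∫ t in Ioo a b, κ j t * (∫ y in (0 : ℝ)..t, ∫ z in (0 : ℝ)..y, v z) = d * 1 + c * G j +
        ∫ t in Ioo a b, primitiveDensity a b (primitiveDensity a b (κ j)) t * v t := by
    intro v hv
    have hv' := hv.mono_set hsubset
    set V : ℝ → ℝ := fun y => ∫ z in (0 : ℝ)..y, v z with hV
    have hVi : IntegrableOn V (Ioo 0 1) := integrableOn_primitive zero_le_one hv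
    set c := V a with hc
    -- On the support extension, `∫_0^x V = ∫_0^a V + V(a)(x - a) + ∫_a^x ∫_a^t v`. The affine part
    -- has slope `V(a)` and the stated constant term, both independent of `j`.
    refine ⟨c, (∫ t in (0 : ℝ)..a, V t) - c * a, fun j hj => ?_⟩
    rw [integral_density_affine_add_primitive hab (c := c)
      (d := (∫ t in (0 : ℝ)..a, V t) - c * a) (u := fun y => ∫ z in a..y, v z)
      (hκm j hj) (hκb j hj) (integrableOn_primitive hab hv') (fun x hx => ?_), hone j hj, hid j hj,
      integral_mul_primitive (hκ1m j hj) (hκ1b j hj) hv']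
    have hcong : ∫ t in a..x, V t = ∫ t in a..x, (c + ∫ z in a..t, v z) := by
      refine intervalIntegral.integral_congr_ae (Filter.Eventually.of_forall fun t ht => ?_)
      rw [uIoc_of_le hx.1.le] at ht
      exact hsplit v hv t ⟨ht.1, ht.2.trans_lt hx.2⟩
    have hi : IntervalIntegrable (fun t => ∫ z in a..t, v z) volume a x := by
      rw [intervalIntegrable_iff_integrableOn_Ioo_of_le hx.1.le]
      exact (integrableOn_primitive hab hv').mono_set (Ioo_subset_Ioo le_rfl hx.2.le)
    rw [hsplit V hVi x hx, hcong, intervalIntegral.integral_add intervalIntegrable_const hi,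
      intervalIntegral.integral_const, smul_eq_mul]
    ring
  -- `i` primitives give `(b - a)^i` and `i` derivatives give `h^{-i}`; their product is at most
  -- `R^i`, so all three kernels are of order `1/h`.
  have hbound : ∀ i : ℕ, i ≤ 2 → N / h * (b - a) ^ i * (6 ^ p / h ^ i) ≤
      N * 6 ^ p * R ^ 2 / h := by
    intro i hi
    have h1 : (b - a) ^ i ≤ (R * h) ^ i := pow_le_pow_left₀ (by linarith) hJ i
    have h2 : R ^ i ≤ R ^ 2 := pow_le_pow_right₀ hR1 hi
    calc N / h * (b - a) ^ i * (6 ^ p / h ^ i) ≤ N / h * (R * h) ^ i * (6 ^ p / h ^ i) := by gcongr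
      _ = N * 6 ^ p * R ^ i / h := by rw [mul_pow]; field_simp
      _ ≤ _ := by gcongr
  refine ⟨(p + 1) * (N * 6 ^ p * R ^ 2 / h), by positivity, ?_, ?_⟩
  · calc (p + 1) * (N * 6 ^ p * R ^ 2 / h) * (b - a)
        ≤ (p + 1) * (N * 6 ^ p * R ^ 2 / h) * (R * h) := by gcongr
      _ = _ := by field_simp
  have hmonoA : ∀ (T : (ℝ → ℝ) → ℝ → ℝ) (i : ℕ), i ≤ 2 →
      IsKernelOp T I (Ioo a b) (s.card * (N / h * (b - a) ^ i * (6 ^ p / h ^ i))) →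
      IsKernelOp T I (Ioo a b) ((p + 1) * (N * 6 ^ p * R ^ 2 / h)) := by
    rintro T i hi ⟨K, k1, k2, k3⟩
    refine ⟨K, k1, fun x hx t => (k2 x hx t).trans ?_, k3⟩
    rw [hcard]
    exact mul_le_mul_of_nonneg_left (hbound i hi) (by positivity)
  rintro T (rfl | rfl | rfl)
  · refine hmonoA _ 0 (by omega) (isKernelOp_of_sum s ha0 hb1 hκm ?_
      (β := bspline ξ p) (fun j _ => measurable_bspline ξ p j) ?_ fun v _ => hproj v)
    · simpa using hκb
    · intro j _ x hx
      simpa using ((hC2 j).deriv_spec hIo hx).2.2.1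
  · refine hmonoA _ 1 (by omega) (isKernelOp_of_sum s ha0 hb1 hκ1m ?_
      (β := fun j => deriv (bspline ξ p j)) (fun j _ => measurable_deriv _) ?_ fun v hv x hx => ?_)
    · simpa using hκ1b
    · intro j _ x hx
      simpa using ((hC2 j).deriv_spec hIo hx).2.2.2.1
    · rw [projC1, (deriv_eq_sum hIo s hC2 (hproj _)).1 x hx,
        Finset.sum_congr rfl fun j hj => by rw [hprim v hv j hj, add_mul],
        Finset.sum_add_distrib, ← Finset.mul_sum]
      have := hunit.1 x hx
      simp only [one_mul, deriv_const] at this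
      -- The common constant multiplies the vanishing sum of first derivatives.
      rw [← this, mul_zero, zero_add]
  · refine hmonoA _ 2 (by omega) (isKernelOp_of_sum s ha0 hb1 hκ2m ?_
      (β := fun j => deriv (deriv (bspline ξ p j))) (fun j _ => measurable_deriv _) ?_
      fun v hv x hx => ?_)
    · simpa [pow_two, mul_assoc] using hκ2b
    · intro j _ x hx
      exact ((hC2 j).deriv_spec hIo hx).2.2.2.2
    · obtain ⟨c, d, hcd⟩ := hprim2 v hv
      have e1 := hunit.2 x hx
      have e2 := hlin.2 x hx
      have e3 : deriv (deriv fun _ : ℝ => (1 : ℝ)) x = 0 := by simp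
      have e4 : deriv (deriv fun y : ℝ => y) x = 0 := by simp
      rw [e3] at e1
      rw [e4] at e2
      have hd := (deriv_eq_sum hIo s hC2
        (hproj (fun t => ∫ y in (0 : ℝ)..t, ∫ z in (0 : ℝ)..y, v z))).2 x hx
      rw [projC2]
      unfold projC1
      rw [hd, Finset.sum_congr rfl fun j hj => by
        rw [hcd j hj, add_mul, add_mul, mul_assoc d, mul_assoc c],
        Finset.sum_add_distrib, Finset.sum_add_distrib,
        ← Finset.mul_sum s (fun j => 1 * deriv (deriv (bspline ξ p j)) x) d,
        ← Finset.mul_sum s (fun j => G j * deriv (deriv (bspline ξ p j)) x) c,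
        ← e1, ← e2, mul_zero, mul_zero, zero_add, zero_add]

/-! ### Integral operators in one variable of a product -/

lemma eLpNorm_two_sq {α : Type*} [MeasurableSpace α] (μ : Measure α) (f : α → ℝ) :
    eLpNorm f 2 μ ^ 2 = ∫⁻ x, ‖f x‖ₑ ^ 2 ∂μ := by
  have := eLpNorm_nnreal_pow_eq_lintegral (f := f) (μ := μ) (p := 2) two_ne_zero
  simpa using this

lemma sq_lintegral_le {α : Type*} [MeasurableSpace α] (μ : Measure α) {f : α → ℝ≥0∞}
    (hf : AEMeasurable f μ) : (∫⁻ x, f x ∂μ) ^ 2 ≤ μ univ * ∫⁻ x, f x ^ 2 ∂μ := by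
  have h := ENNReal.lintegral_mul_le_Lp_mul_Lq μ (p := 2) (q := 2)
    (Real.holderConjugate_iff.2 ⟨one_lt_two, by norm_num⟩) (f := fun _ => 1) aemeasurable_const hf
  simp only [Pi.mul_apply, one_mul, lintegral_const, ENNReal.rpow_ofNat, one_pow] at h
  calc (∫⁻ x, f x ∂μ) ^ 2 ≤ (μ univ ^ (1 / 2 : ℝ) * (∫⁻ x, f x ^ 2 ∂μ) ^ (1 / 2 : ℝ)) ^ 2 := by
        gcongr
    _ = _ := by
        rw [mul_pow, ← ENNReal.rpow_natCast, ← ENNReal.rpow_mul, ← ENNReal.rpow_natCast,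
          ← ENNReal.rpow_mul]
        norm_num

/-- Cauchy–Schwarz bounds the square of the slice-wise integral by `A² |J|` times the squared norm
of the slice over `J`. Integration over `I` adds the factor `|I| ≤ |J|`, giving `(A |J|)²` in total.
-/
theorem IsKernelOp.memLp_prod {Y : Type*} [MeasurableSpace Y] {ν : Measure Y} [IsFiniteMeasure ν]
    {T : (ℝ → ℝ) → ℝ → ℝ} {I J : Set ℝ} {A : ℝ} {C : ℝ≥0} (hT : IsKernelOp T I J A)
    (hI : MeasurableSet I) (hIJ : I ⊆ J) (hJ : J ⊆ Ioo 0 1)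
    (hC : ENNReal.ofReal A * volume J ≤ C) {F : ℝ × Y → ℝ}
    (hF : MemLp F 2 ((volume.restrict (Ioo 0 1)).prod ν)) :
    MemLp (fun z : ℝ × Y => T (fun t => F (t, z.2)) z.1) 2 ((volume.restrict I).prod ν) ∧
      eLpNorm (fun z : ℝ × Y => T (fun t => F (t, z.2)) z.1) 2 ((volume.restrict I).prod ν) ≤
        C * eLpNorm F 2 ((volume.restrict J).prod ν) := by
  obtain ⟨K, hKm, hKb, hK⟩ := hT
  have hle : (volume.restrict J).prod ν ≤ (volume.restrict (Ioo 0 1)).prod ν :=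
    Measure.prod_mono (Measure.restrict_mono hJ le_rfl) le_rfl
  have hFJ : MemLp F 2 ((volume.restrict J).prod ν) := hF.mono_measure hle
  -- The kernel formula is available for integrable functions on all of `(0, 1)`. On a finite
  -- measure space `L²` lies in `L¹`, so Fubini provides this for almost every slice.
  have hslice : ∀ᵐ y ∂ν, IntegrableOn (fun t => F (t, y)) (Ioo 0 1) :=
    (hF.integrable one_le_two).prod_left_ae
  have hgood : ∀ᵐ z ∂(volume.restrict I).prod ν,
      z.1 ∈ I ∧ IntegrableOn (fun t => F (t, z.2)) (Ioo 0 1) :=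
    (Measure.quasiMeasurePreserving_fst.ae (ae_restrict_mem hI)).and
      (Measure.quasiMeasurePreserving_snd.ae hslice)
  have heq : (fun z : ℝ × Y => T (fun t => F (t, z.2)) z.1) =ᵐ[(volume.restrict I).prod ν]
      fun z => ∫ s in J, K (z.1, s) * F (s, z.2) := by
    filter_upwards [hgood] with z hz using hK _ hz.2 _ hz.1
  have hmeas : AEStronglyMeasurable (fun z : ℝ × Y => ∫ s in J, K (z.1, s) * F (s, z.2))
      ((volume.restrict I).prod ν) := by
    refine AEStronglyMeasurable.integral_prod_right'
      (f := fun q : (ℝ × Y) × ℝ => K (q.1.1, q.2) * F (q.2, q.1.2)) ?_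
    refine AEStronglyMeasurable.mul ?_ ?_
    · exact (hKm.comp (by fun_prop : Measurable fun q : (ℝ × Y) × ℝ =>
        (q.1.1, q.2))).aestronglyMeasurable
    · have hq : Measure.QuasiMeasurePreserving (fun q : (ℝ × Y) × ℝ => (q.2, q.1.2))
          (((volume.restrict I).prod ν).prod (volume.restrict J)) ((volume.restrict J).prod ν) := by
        have h1 : Measure.QuasiMeasurePreserving (fun q : (ℝ × Y) × ℝ => (q.1.2, q.2))
            (((volume.restrict I).prod ν).prod (volume.restrict J))
            (ν.prod (volume.restrict J)) := by
          have h2 := (measurePreserving_prodAssoc (volume.restrict I) ν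
            (volume.restrict J)).quasiMeasurePreserving
          exact Measure.quasiMeasurePreserving_snd.comp h2
        exact (Measure.measurePreserving_swap (μ := ν)
          (ν := volume.restrict J)).quasiMeasurePreserving.comp h1
      exact hFJ.1.comp_quasiMeasurePreserving hq
  set H : Y → ℝ≥0∞ := fun y => ∫⁻ s in J, ‖F (s, y)‖ₑ ^ 2 with hH
  have hFm : AEMeasurable (fun z => ‖F z‖ₑ ^ 2) ((volume.restrict J).prod ν) :=
    hFJ.1.enorm.pow_const 2
  have hHm : AEMeasurable H ν := hFm.lintegral_prod_left'
  have hHint : ∫⁻ y, H y ∂ν = eLpNorm F 2 ((volume.restrict J).prod ν) ^ 2 := by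
    rw [eLpNorm_two_sq, lintegral_prod_symm _ hFm]
  have hpt : ∀ᵐ z ∂(volume.restrict I).prod ν, ‖∫ s in J, K (z.1, s) * F (s, z.2)‖ₑ ^ 2 ≤
      ENNReal.ofReal A ^ 2 * volume J * H z.2 := by
    filter_upwards [hgood] with z hz
    have hm : AEMeasurable (fun s => ‖F (s, z.2)‖ₑ) (volume.restrict J) :=
      (hz.2.mono_set hJ).aestronglyMeasurable.enorm
    have h1 : ‖∫ s in J, K (z.1, s) * F (s, z.2)‖ₑ ≤
        ENNReal.ofReal A * ∫⁻ s in J, ‖F (s, z.2)‖ₑ := by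
      refine (enorm_integral_le_lintegral_enorm _).trans ?_
      rw [← lintegral_const_mul'' _ hm]
      refine lintegral_mono fun s => ?_
      rw [enorm_mul]
      gcongr
      rw [← ofReal_norm]
      exact ENNReal.ofReal_le_ofReal (hKb _ hz.1 s)
    have h2 := sq_lintegral_le _ hm
    rw [Measure.restrict_apply_univ] at h2
    calc _ ≤ (ENNReal.ofReal A * ∫⁻ s in J, ‖F (s, z.2)‖ₑ) ^ 2 := by gcongr
      _ = ENNReal.ofReal A ^ 2 * (∫⁻ s in J, ‖F (s, z.2)‖ₑ) ^ 2 := mul_pow _ _ _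
      _ ≤ ENNReal.ofReal A ^ 2 * (volume J * H z.2) := by gcongr
      _ = _ := (mul_assoc _ _ _).symm
  have hnorm : eLpNorm (fun z : ℝ × Y => ∫ s in J, K (z.1, s) * F (s, z.2)) 2
      ((volume.restrict I).prod ν) ≤ C * eLpNorm F 2 ((volume.restrict J).prod ν) := by
    refine (ENNReal.pow_le_pow_left_iff two_ne_zero).1 ?_
    rw [eLpNorm_two_sq]
    have hHs : AEMeasurable (fun z : ℝ × Y => H z.2) ((volume.restrict I).prod ν) :=
      hHm.comp_quasiMeasurePreserving Measure.quasiMeasurePreserving_snd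
    calc _ ≤ ∫⁻ z, ENNReal.ofReal A ^ 2 * volume J * H z.2 ∂(volume.restrict I).prod ν :=
          lintegral_mono_ae hpt
      _ = ENNReal.ofReal A ^ 2 * volume J * ((∫⁻ y, H y ∂ν) * volume I) := by
          rw [lintegral_const_mul'' _ hHs, lintegral_prod_symm _ hHs]
          simp only [lintegral_const, Measure.restrict_apply_univ]
          rw [lintegral_mul_const'' _ hHm]
      _ ≤ ENNReal.ofReal A ^ 2 * volume J * ((∫⁻ y, H y ∂ν) * volume J) := by gcongr
      _ = (ENNReal.ofReal A * volume J) ^ 2 * ∫⁻ y, H y ∂ν := by ring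
      _ ≤ (C : ℝ≥0∞) ^ 2 * ∫⁻ y, H y ∂ν := by gcongr
      _ = _ := by rw [hHint, mul_pow]
  rw [eLpNorm_congr_ae heq, memLp_congr_ae heq]
  refine ⟨⟨hmeas, hnorm.trans_lt ?_⟩, hnorm⟩
  exact ENNReal.mul_lt_top ENNReal.coe_lt_top hFJ.2

/-! ### Tensor products -/

lemma measurePreserving_box (s : Fin 3 → Set ℝ) (l : Fin 3) (A : Set ℝ) :
    MeasurePreserving (MeasurableEquiv.piFinSuccAbove (fun _ => ℝ) l)
      (volume.restrict (univ.pi (Function.update s l A)))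
      ((volume.restrict A).prod (Measure.pi fun i => volume.restrict (s (l.succAbove i)))) := by
  have h := measurePreserving_piFinSuccAbove
    (fun i => (volume : Measure ℝ).restrict (Function.update s l A i)) l
  have h1 : Measure.pi (fun i => (volume : Measure ℝ).restrict (Function.update s l A i)) =
      volume.restrict (univ.pi (Function.update s l A)) :=
    (Measure.restrict_pi_pi _ _).symm
  rw [h1] at h
  simpa [Function.update_of_ne (Fin.succAbove_ne l _)] using h

/-- The set in direction `l` is `(0, 1)` in the hypothesis, `I` on the left and `J` on the right of
the estimate; the sets in the other directions stay fixed. This freedom allows the mixed boxes that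
arise between successive operators. -/
lemma IsKernelOp.memLp_actOn {T : (ℝ → ℝ) → ℝ → ℝ} {I J : Set ℝ} {A : ℝ} {C : ℝ≥0}
    (hT : IsKernelOp T I J A) (hI : MeasurableSet I) (hIJ : I ⊆ J) (hJ : J ⊆ Ioo 0 1)
    (hC : ENNReal.ofReal A * volume J ≤ C) (l : Fin 3) {s : Fin 3 → Set ℝ}
    (hs : ∀ i, s i ⊆ Ioo 0 1) {f : (Fin 3 → ℝ) → ℝ}
    (hf : MemLp f 2 (volume.restrict (univ.pi (Function.update s l (Ioo 0 1))))) :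
    MemLp (actOn l T f) 2 (volume.restrict (univ.pi (Function.update s l I))) ∧
      eLpNorm (actOn l T f) 2 (volume.restrict (univ.pi (Function.update s l I))) ≤
        C * eLpNorm f 2 (volume.restrict (univ.pi (Function.update s l J))) := by
  have hfin : ∀ i, IsFiniteMeasure ((volume : Measure ℝ).restrict (s i)) := fun i =>
    isFiniteMeasure_restrict.2 ((measure_mono (hs i)).trans_lt (by simp)).ne
  set e := MeasurableEquiv.piFinSuccAbove (fun _ : Fin 3 => ℝ) l with he
  have hmap : ∀ A, Measure.map e.symm
      ((volume.restrict A).prod (Measure.pi fun i => volume.restrict (s (l.succAbove i)))) =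
      volume.restrict (univ.pi (Function.update s l A)) := fun A =>
    ((measurePreserving_box s l A).symm e).map_eq
  have hemb : MeasurableEmbedding e.symm := e.symm.measurableEmbedding
  have hact : actOn l T f ∘ e.symm = fun z => T (fun t => (f ∘ e.symm) (t, z.2)) z.1 := by
    funext z
    have h1 : ∀ z, e.symm z = Fin.insertNth (α := fun _ => ℝ) l z.1 z.2 := fun z => rfl
    simp only [Function.comp_apply, actOn, h1, Fin.insertNth_apply_same, Fin.update_insertNth]
  rw [← hmap, hemb.memLp_map_measure_iff] at hf
  rw [← hmap, ← hmap, hemb.memLp_map_measure_iff, hemb.eLpNorm_map_measure,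
    hemb.eLpNorm_map_measure, hact]
  exact hT.memLp_prod hI hIJ hJ hC hf

lemma memLp_tensor {T : Fin 3 → (ℝ → ℝ) → ℝ → ℝ} {I J : Fin 3 → Set ℝ} {A : Fin 3 → ℝ} {C : ℝ≥0}
    (hT : ∀ l, IsKernelOp (T l) (I l) (J l) (A l)) (hI : ∀ l, MeasurableSet (I l))
    (hIJ : ∀ l, I l ⊆ J l) (hJ : ∀ l, J l ⊆ Ioo 0 1)
    (hC : ∀ l, ENNReal.ofReal (A l) * volume (J l) ≤ C) {f : (Fin 3 → ℝ) → ℝ}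
    (hf : MemL2 cube f) :
    MemL2 (univ.pi I) (tensor (T 0) (T 1) (T 2) f) ∧
      normL2 (univ.pi I) (tensor (T 0) (T 1) (T 2) f) ≤ (C ^ 3 : ℝ≥0) * normL2 (univ.pi J) f := by
  unfold MemL2 normL2 tensor
  have hI1 : ∀ l, I l ⊆ Ioo 0 1 := fun l => (hIJ l).trans (hJ l)
  set U : Set ℝ := Ioo 0 1 with hU
  have step : ∀ (l : Fin 3) (s : Fin 3 → Set ℝ), (∀ i, s i ⊆ U) → ∀ g : (Fin 3 → ℝ) → ℝ,
      MemLp g 2 (volume.restrict (univ.pi (Function.update s l U))) →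
      MemLp (actOn l (T l) g) 2 (volume.restrict (univ.pi (Function.update s l (I l)))) ∧
      eLpNorm (actOn l (T l) g) 2 (volume.restrict (univ.pi (Function.update s l (I l)))) ≤
        C * eLpNorm g 2 (volume.restrict (univ.pi (Function.update s l (J l)))) :=
    fun l s hs g hg => (hT l).memLp_actOn (hI l) (hIJ l) (hJ l) (hC l) l hs hg
  have u0 : ∀ a b c d : Set ℝ, Function.update ![a, b, c] 0 d = ![d, b, c] := fun a b c d => by
    ext i; fin_cases i <;> rfl
  have u1 : ∀ a b c d : Set ℝ, Function.update ![a, b, c] 1 d = ![a, d, c] := fun a b c d => by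
    ext i; fin_cases i <;> rfl
  have u2 : ∀ a b c d : Set ℝ, Function.update ![a, b, c] 2 d = ![a, b, d] := fun a b c d => by
    ext i; fin_cases i <;> rfl
  have hsub : ∀ a b c : Set ℝ, a ⊆ U → b ⊆ U → c ⊆ U → ∀ i, (![a, b, c] : Fin 3 → Set ℝ) i ⊆ U := by
    intro a b c ha hb hc i
    fin_cases i <;> assumption
  have hcube : cube = univ.pi ![U, U, U] := by
    unfold cube
    congr 1
    ext i; fin_cases i <;> rfl
  have hIv : I = ![I 0, I 1, I 2] := by ext i; fin_cases i <;> rfl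
  have hJv : J = ![J 0, J 1, J 2] := by ext i; fin_cases i <;> rfl
  have hmonoS : ∀ {a b c a' b' c' : Set ℝ} {g : (Fin 3 → ℝ) → ℝ}, a ⊆ a' → b ⊆ b' → c ⊆ c' →
      MemLp g 2 (volume.restrict (univ.pi ![a', b', c'])) →
      MemLp g 2 (volume.restrict (univ.pi ![a, b, c])) := by
    intro a b c a' b' c' g ha hb hc hg
    refine hg.mono_measure (Measure.restrict_mono (pi_mono fun i _ => ?_) le_rfl)
    fin_cases i <;> assumption
  rw [hcube] at hf
  rw [hIv, hJv]
  set g₂ := actOn 2 (T 2) f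
  set g₁ := actOn 1 (T 1) g₂
  -- The operators act in the order `2, 1, 0`. Membership is kept on all of `(0, 1)` in the
  -- directions not yet treated, since the next operator needs whole slices there.
  have m2 := (step 2 ![U, U, U] (hsub _ _ _ le_rfl le_rfl le_rfl) f (by rwa [u2])).1
  rw [u2] at m2
  have m1 := (step 1 ![U, U, I 2] (hsub _ _ _ le_rfl le_rfl (hI1 2)) g₂ (by rwa [u1])).1
  rw [u1] at m1
  obtain ⟨m0, n0⟩ := step 0 ![U, I 1, I 2] (hsub _ _ _ le_rfl (hI1 1) (hI1 2)) g₁ (by rwa [u0])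
  rw [u0] at m0
  rw [u0, u0] at n0
  -- The norms are followed backwards along `I₀×I₁×I₂`, `J₀×I₁×I₂`, `J₀×J₁×I₂`, `J₀×J₁×J₂`, at the
  -- price of one factor `C` per direction.
  have n1 := (step 1 ![J 0, U, I 2] (hsub _ _ _ (hJ 0) le_rfl (hI1 2)) g₂
    (by rw [u1]; exact hmonoS (hJ 0) le_rfl le_rfl m2)).2
  rw [u1, u1] at n1
  have n2 := (step 2 ![J 0, J 1, U] (hsub _ _ _ (hJ 0) (hJ 1) le_rfl) f
    (by rw [u2]; exact hmonoS (hJ 0) (hJ 1) le_rfl hf)).2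
  rw [u2, u2] at n2
  refine ⟨m0, n0.trans ?_⟩
  calc _ ≤ (C : ℝ≥0∞) * (C * (C * eLpNorm f 2 (volume.restrict (univ.pi ![J 0, J 1, J 2])))) := by
        gcongr
        exact n1.trans (by gcongr)
    _ = _ := by push_cast; ring

/-! ### From entries to matrix and vector norms. -/

lemma sq_rpow_half (x : ℝ≥0∞) : (x ^ 2) ^ (1 / 2 : ℝ) = x := by
  rw [← ENNReal.rpow_natCast, ← ENNReal.rpow_mul]
  norm_num

/-- If each entry of `M` is controlled by an entry of `N`, then so is the matrix norm. -/
lemma matNormL2_le {D E : Set (Fin 3 → ℝ)} {M N : (Fin 3 → ℝ) → Matrix (Fin 3) (Fin 3) ℝ}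
    {C : ℝ≥0} (h : ∀ a b, ∃ a' b', normL2 D (fun x => M x a b) ≤ C * normL2 E (fun x => N x a' b')) :
    matNormL2 D M ≤ (3 * C : ℝ≥0) * matNormL2 E N := by
  have hN : ∀ a b, normL2 E (fun x => N x a b) ≤ matNormL2 E N := by
    intro a b
    rw [← sq_rpow_half (normL2 E fun x => N x a b), matNormL2]
    gcongr
    exact (Finset.single_le_sum (f := fun b => normL2 E (fun x => N x a b) ^ 2)
      (fun _ _ => zero_le) (Finset.mem_univ b)).trans
      (Finset.single_le_sum (f := fun a => ∑ b, normL2 E (fun x => N x a b) ^ 2)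
      (fun _ _ => zero_le) (Finset.mem_univ a))
  have hM : ∀ a b, normL2 D (fun x => M x a b) ≤ C * matNormL2 E N := fun a b => by
    obtain ⟨a', b', hab⟩ := h a b
    exact hab.trans (by gcongr; exact hN a' b')
  calc matNormL2 D M ≤ (∑ _a : Fin 3, ∑ _b : Fin 3, (C * matNormL2 E N) ^ 2) ^ (1 / 2 : ℝ) := by
        unfold matNormL2
        gcongr with a _ b _
        exact hM a b
    -- Each of the nine entries is bounded by the whole norm of `N`, whence `3 = √9`. This crude
    -- count permits one entry of `N` to serve several entries of `M`, as the symmetric `Π²`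
    -- requires.
    _ = ((3 * (C * matNormL2 E N)) ^ 2) ^ (1 / 2 : ℝ) := by
        congr 1
        simp only [Finset.sum_const, Finset.card_univ, Fintype.card_fin, nsmul_eq_mul]
        push_cast
        ring
    _ = _ := by rw [sq_rpow_half]; push_cast; ring

lemma vecNormL2_le {D E : Set (Fin 3 → ℝ)} {v w : (Fin 3 → ℝ) → Fin 3 → ℝ} {C : ℝ≥0}
    (h : ∀ a, normL2 D (fun x => v x a) ≤ C * normL2 E (fun x => w x a)) :
    vecNormL2 D v ≤ C * vecNormL2 E w := by
  calc vecNormL2 D v ≤ (∑ a, (C * normL2 E (fun x => w x a)) ^ 2) ^ (1 / 2 : ℝ) := by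
        unfold vecNormL2
        gcongr with a _
        exact h a
    _ = (C ^ 2 * ∑ a, normL2 E (fun x => w x a) ^ 2) ^ (1 / 2 : ℝ) := by
        simp only [mul_pow, Finset.mul_sum]
    _ = _ := by rw [ENNReal.mul_rpow_of_nonneg _ _ (by norm_num), sq_rpow_half, vecNormL2]

end SplineHessian

/-! ### The stability estimate. -/

theorem mainTheorem6 (p r : Fin 3 → ℕ) (hp : ∀ l, 2 ≤ p l) (hr : ∀ l, 1 ≤ r l)
    (hrp : ∀ l, r l < p l) (cu : ℝ) :
    ∃ C : ℝ≥0, ∀ Ξ : ∀ l, OpenKnots (p l),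
      (∀ l, (Ξ l).HasRegularity (r l)) → (∀ l, (Ξ l).IsRegular cu) →
      ∀ j : Fin 3 → ℕ, (∀ l, (Ξ l).IsElement (j l)) →
        (∀ φ : (Fin 3 → ℝ) → ℝ, MemL2 cube φ →
          MemL2 (element Ξ j) (proj1 Ξ φ) ∧
          normL2 (element Ξ j) (proj1 Ξ φ) ≤ C * normL2 (extension Ξ j) φ) ∧
        (∀ S : (Fin 3 → ℝ) → Matrix (Fin 3) (Fin 3) ℝ,
          (∀ a b, MemL2 cube (fun x => S x a b)) →
          (∀ a b, MemL2 (element Ξ j) (fun x => proj2 Ξ S x a b)) ∧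
          matNormL2 (element Ξ j) (proj2 Ξ S) ≤ C * matNormL2 (extension Ξ j) S) ∧
        (∀ T : (Fin 3 → ℝ) → Matrix (Fin 3) (Fin 3) ℝ,
          (∀ a b, MemL2 cube (fun x => T x a b)) →
          (∀ a b, MemL2 (element Ξ j) (fun x => proj3 Ξ T x a b)) ∧
          matNormL2 (element Ξ j) (proj3 Ξ T) ≤ C * matNormL2 (extension Ξ j) T) ∧
        (∀ v : (Fin 3 → ℝ) → Fin 3 → ℝ, (∀ a, MemL2 cube (fun x => v x a)) →
          (∀ a, MemL2 (element Ξ j) (fun x => proj4 Ξ v x a)) ∧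
          vecNormL2 (element Ξ j) (proj4 Ξ v) ≤ C * vecNormL2 (extension Ξ j) v) := by
  choose C hC0 hC using fun l => exists_isKernelOp (one_le_two.trans (hp l)) cu
  -- A single constant dominating all three directions. It is cubed by the tensor product, and the
  -- further factor `3` comes from the matrix norm.
  set C₀ : ℝ≥0 := ∑ l, (C l).toNNReal with hC₀
  refine ⟨3 * C₀ ^ 3, fun Ξ _ hreg j hj => ?_⟩
  choose A hA0 hAC hA using fun l => hC l (Ξ l) (hreg l) (j l) (hj l)
  have hIJ : ∀ l, Ioo ((Ξ l).knot (j l)) ((Ξ l).knot (j l + 1)) ⊆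
      Ioo ((Ξ l).knot (j l - p l)) ((Ξ l).knot (j l + p l + 1)) := fun l =>
    Ioo_subset_Ioo ((Ξ l).mono (by omega)) ((Ξ l).mono (by omega))
  have hJ : ∀ l, Ioo ((Ξ l).knot (j l - p l)) ((Ξ l).knot (j l + p l + 1)) ⊆ Ioo 0 1 := fun l =>
    Ioo_subset_Ioo ((Ξ l).knot_nonneg _) ((Ξ l).knot_le_one _)
  have hCJ : ∀ l, ENNReal.ofReal (A l) *
      volume (Ioo ((Ξ l).knot (j l - p l)) ((Ξ l).knot (j l + p l + 1))) ≤ C₀ := by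
    intro l
    rw [Real.volume_Ioo, ← ENNReal.ofReal_mul (hA0 l)]
    refine (ENNReal.ofReal_le_ofReal (hAC l)).trans (ENNReal.coe_le_coe.2 ?_)
    exact Finset.single_le_sum (f := fun l => (C l).toNNReal) (fun _ _ => zero_le)
      (Finset.mem_univ l)
  have key : ∀ T₀ ∈ ({proj (Ξ 0), projC1 (Ξ 0), projC2 (Ξ 0)} : Set ((ℝ → ℝ) → ℝ → ℝ)),
      ∀ T₁ ∈ ({proj (Ξ 1), projC1 (Ξ 1), projC2 (Ξ 1)} : Set ((ℝ → ℝ) → ℝ → ℝ)),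
      ∀ T₂ ∈ ({proj (Ξ 2), projC1 (Ξ 2), projC2 (Ξ 2)} : Set ((ℝ → ℝ) → ℝ → ℝ)),
      ∀ f : (Fin 3 → ℝ) → ℝ, MemL2 cube f → MemL2 (element Ξ j) (tensor T₀ T₁ T₂ f) ∧
        normL2 (element Ξ j) (tensor T₀ T₁ T₂ f) ≤ (C₀ ^ 3 : ℝ≥0) * normL2 (extension Ξ j) f := by
    intro T₀ h₀ T₁ h₁ T₂ h₂ f hf
    refine memLp_tensor (T := ![T₀, T₁, T₂]) (A := A) (fun l => hA l _ ?_)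
      (fun l => measurableSet_Ioo) hIJ hJ hCJ hf
    fin_cases l
    · exact h₀
    · exact h₁
    · exact h₂
  have z : ∀ l, proj (Ξ l) ∈
      ({proj (Ξ l), projC1 (Ξ l), projC2 (Ξ l)} : Set ((ℝ → ℝ) → ℝ → ℝ)) := fun l => by simp
  have o : ∀ l, projC1 (Ξ l) ∈
      ({proj (Ξ l), projC1 (Ξ l), projC2 (Ξ l)} : Set ((ℝ → ℝ) → ℝ → ℝ)) := fun l => by simp
  have t : ∀ l, projC2 (Ξ l) ∈
      ({proj (Ξ l), projC1 (Ξ l), projC2 (Ξ l)} : Set ((ℝ → ℝ) → ℝ → ℝ)) := fun l => by simp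
  have h3 : C₀ ^ 3 ≤ 3 * C₀ ^ 3 := le_mul_of_one_le_left zero_le (by norm_num)
  have h3' : ((C₀ ^ 3 : ℝ≥0) : ℝ≥0∞) ≤ (3 * C₀ ^ 3 : ℝ≥0) := ENNReal.coe_le_coe.2 h3
  refine ⟨fun φ hφ => ?_, fun S hS => ?_, fun T hT => ?_, fun v hv => ?_⟩
  · obtain ⟨k1, k2⟩ := key _ (z 0) _ (z 1) _ (z 2) φ hφ
    exact ⟨k1, k2.trans (by gcongr)⟩
  · have H : ∀ a b, ∃ a' b', MemL2 (element Ξ j) (fun x => proj2 Ξ S x a b) ∧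
        normL2 (element Ξ j) (fun x => proj2 Ξ S x a b) ≤
          (C₀ ^ 3 : ℝ≥0) * normL2 (extension Ξ j) (fun x => S x a' b') := by
      intro a b
      fin_cases a <;> fin_cases b
      · exact ⟨0, 0, key _ (t 0) _ (z 1) _ (z 2) _ (hS 0 0)⟩
      · exact ⟨0, 1, key _ (o 0) _ (o 1) _ (z 2) _ (hS 0 1)⟩
      · exact ⟨0, 2, key _ (o 0) _ (z 1) _ (o 2) _ (hS 0 2)⟩
      · exact ⟨0, 1, key _ (o 0) _ (o 1) _ (z 2) _ (hS 0 1)⟩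
      · exact ⟨1, 1, key _ (z 0) _ (t 1) _ (z 2) _ (hS 1 1)⟩
      · exact ⟨1, 2, key _ (z 0) _ (o 1) _ (o 2) _ (hS 1 2)⟩
      · exact ⟨0, 2, key _ (o 0) _ (z 1) _ (o 2) _ (hS 0 2)⟩
      · exact ⟨1, 2, key _ (z 0) _ (o 1) _ (o 2) _ (hS 1 2)⟩
      · exact ⟨2, 2, key _ (z 0) _ (z 1) _ (t 2) _ (hS 2 2)⟩
    refine ⟨fun a b => ?_, matNormL2_le fun a b => ?_⟩
    · obtain ⟨_, _, h, _⟩ := H a b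
      exact h
    · obtain ⟨a', b', _, h⟩ := H a b
      exact ⟨a', b', h⟩
  · have H : ∀ a b, MemL2 (element Ξ j) (fun x => proj3 Ξ T x a b) ∧
        normL2 (element Ξ j) (fun x => proj3 Ξ T x a b) ≤
          (C₀ ^ 3 : ℝ≥0) * normL2 (extension Ξ j) (fun x => T x a b) := by
      intro a b
      fin_cases a <;> fin_cases b
      · exact key _ (o 0) _ (o 1) _ (o 2) _ (hT 0 0)
      · exact key _ (t 0) _ (z 1) _ (o 2) _ (hT 0 1)
      · exact key _ (t 0) _ (o 1) _ (z 2) _ (hT 0 2)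
      · exact key _ (z 0) _ (t 1) _ (o 2) _ (hT 1 0)
      · exact key _ (o 0) _ (o 1) _ (o 2) _ (hT 1 1)
      · exact key _ (o 0) _ (t 1) _ (z 2) _ (hT 1 2)
      · exact key _ (z 0) _ (o 1) _ (t 2) _ (hT 2 0)
      · exact key _ (o 0) _ (z 1) _ (t 2) _ (hT 2 1)
      · exact key _ (o 0) _ (o 1) _ (o 2) _ (hT 2 2)
    exact ⟨fun a b => (H a b).1, matNormL2_le fun a b => ⟨a, b, (H a b).2⟩⟩
  · have H : ∀ a, MemL2 (element Ξ j) (fun x => proj4 Ξ v x a) ∧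
        normL2 (element Ξ j) (fun x => proj4 Ξ v x a) ≤
          (C₀ ^ 3 : ℝ≥0) * normL2 (extension Ξ j) (fun x => v x a) := by
      intro a
      fin_cases a
      · exact key _ (t 0) _ (o 1) _ (o 2) _ (hv 0)
      · exact key _ (o 0) _ (t 1) _ (o 2) _ (hv 1)
      · exact key _ (o 0) _ (o 1) _ (t 2) _ (hv 2)
    refine ⟨fun a => (H a).1, (vecNormL2_le fun a => (H a).2).trans ?_⟩
    gcongr
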